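/- Let $f:\mathbb{C}\to\mathbb{C}$ be a transcendental entire function (entire and not a polynomial), and let $f^n$, $n\ge 0$, denote its iterates. The Fatou set $F(f)$ is the set of points having a neighbourhood on which $(f^n)_{n\in\mathbb{N}}$ is a normal family (limits $\infty$ being allowed), and $J(f)=\mathbb{C}\setminus F(f)$ is the Julia set. A Fatou component is a connected component of $F(f)$; it is multiply connected if it is not simply connected. Write $M(r,f)=\max_{|z|=r}|f(z)|$ and let $M^n(r,f)$ be the $n$th iterate of $M(\cdot,f)$ with respect to $r$. Let $R>0$ be such that $M(r,f)>r$ for all $r\ge R$, and put \[ I(f)=\{z: f^n(z)\to\infty \text{ as } n\to\infty\},\qquad A_R(f)=\{z: |f^n(z)|\ge M^n(R,f)\text{ for all } n\ge 0\}, \] \[ A(f)=\{z:\text{there exists } L\in\mathbb{N}\text{ such that } |f^{n+L}(z)|\ge M^n(R,f)\text{ for all } n\ge 0\} \] (the set $A(f)$ does not depend on the choice of $R$). A set $E\subset\mathbb{C}$ is called a spider's web if $E$ is connected and there is a sequence of bounded simply connected domains $G_n$ with $G_n\subset G_{n+1}$ and $\partial G_n\subset E$ for all $n$, and $\bigcup_n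 G_n=\mathbb{C}$. Suppose that $A_R(f)$ is a spider's web. Then: (a) If $f$ has no multiply connected Fatou components, then each of $A_R(f)\cap J(f)$, $A(f)\cap J(f)$, $I(f)\cap J(f)$ and $J(f)$ is a spider's web. (b) $f$ has no unbounded Fatou components. -/

import Mathlib

open Set Filter Topology

namespace EntireDynamics

noncomputable section

/-- `f : ℂ → ℂ` is a transcendental entire function: entire and not a polynomial function. -/
def IsTranscendentalEntire (f : ℂ → ℂ) : Prop :=
  Differentiable ℂ f ∧ ¬ ∃ p : Polynomial ℂ, ∀ z : ℂ, f z = p.eval z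

/-- The maximum modulus `M(r, f) = max {|f(z)| : |z| = r}`
(the supremum is attained for continuous `f` and `r ≥ 0`). -/
def maxModulus (f : ℂ → ℂ) (r : ℝ) : ℝ :=
  sSup ((fun z : ℂ => ‖f z‖) '' Metric.sphere (0 : ℂ) r)

/-- A sequence of functions tends to `∞` locally uniformly (uniformly on compact subsets)
on `U`. -/
def TendsToInftyLocallyUniformlyOn (F : ℕ → ℂ → ℂ) (U : Set ℂ) : Prop :=
  ∀ K : Set ℂ, K ⊆ U → IsCompact K → ∀ C : ℝ, ∀ᶠ n in atTop, ∀ z ∈ K, C ≤ ‖F n z‖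

/-- Normality of a family `(F n)` of entire functions on a connected open set `U`: every sequence
of members of the family has a subsequence converging locally uniformly on `U` either to a finite
function (necessarily holomorphic on `U`) or to `∞`. -/
def IsNormalFamilyOn (F : ℕ → ℂ → ℂ) (U : Set ℂ) : Prop :=
  ∀ φ : ℕ → ℕ, ∃ ψ : ℕ → ℕ, StrictMono ψ ∧
    ((∃ g : ℂ → ℂ, TendstoLocallyUniformlyOn (fun n => F (φ (ψ n))) g atTop U) ∨
      TendsToInftyLocallyUniformlyOn (fun n => F (φ (ψ n))) U)

/-- The Fatou set `F(f)`: the points having a neighbourhood (which may be taken to be a disc) on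
which the iterates of `f` form a normal family. -/
def fatouSet (f : ℂ → ℂ) : Set ℂ :=
  {z | ∃ r : ℝ, 0 < r ∧ IsNormalFamilyOn (fun n => f^[n]) (Metric.ball z r)}

/-- The Julia set `J(f)`, the complement of the Fatou set. -/
def juliaSet (f : ℂ → ℂ) : Set ℂ := (fatouSet f)ᶜ

/-- `U` is a Fatou component of `f`: a connected component of the Fatou set. -/
def IsFatouComponent (f : ℂ → ℂ) (U : Set ℂ) : Prop :=
  ∃ z ∈ fatouSet f, U = connectedComponentIn (fatouSet f) z

/-- A Fatou component that is not simply connected. -/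
def IsMultiplyConnectedFatouComponent (f : ℂ → ℂ) (U : Set ℂ) : Prop :=
  IsFatouComponent f U ∧ ¬ IsSimplyConnected U

/-- The escaping set `I(f)`. -/
def escapingSet (f : ℂ → ℂ) : Set ℂ :=
  {z | Tendsto (fun n : ℕ => ‖f^[n] z‖) atTop atTop}

/-- `A_R(f) = {z : |fⁿ(z)| ≥ Mⁿ(R, f) for n = 0, 1, 2, …}`, where `Mⁿ(·, f)` is the `n`-th
iterate of `r ↦ M(r, f)`. -/
def fastEscapingLevel (f : ℂ → ℂ) (R : ℝ) : Set ℂ :=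
  {z | ∀ n : ℕ, (maxModulus f)^[n] R ≤ ‖f^[n] z‖}

/-- The fast escaping set
`A(f) = {z : there is L such that |f^(n+L)(z)| ≥ Mⁿ(R, f) for n = 0, 1, 2, …}`.
Here `R` is any positive number with `M(r, f) > r` for all `r ≥ R`; the set does not depend on
which such `R` is used. -/
def fastEscapingSet (f : ℂ → ℂ) (R : ℝ) : Set ℂ :=
  {z | ∃ L : ℕ, ∀ n : ℕ, (maxModulus f)^[n] R ≤ ‖f^[n + L] z‖}

/-- An (infinite) spider's web: a connected set `E` for which there is an increasing sequence of
bounded simply connected domains with boundaries in `E` and with union `ℂ`. -/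
def IsSpidersWeb (E : Set ℂ) : Prop :=
  IsConnected E ∧ ∃ G : ℕ → Set ℂ,
    (∀ n, IsOpen (G n) ∧ IsSimplyConnected (G n) ∧ Bornology.IsBounded (G n)) ∧
    (∀ n, G n ⊆ G (n + 1)) ∧
    (∀ n, frontier (G n) ⊆ E) ∧
    (⋃ n, G n) = univ

end

end EntireDynamics

open EntireDynamics

namespace EntireDynamics

noncomputable section

/-- The total variation of `log (· - q)` along the polygonal path with vertices `a` and `l`. -/
def windingSum (q : ℂ) : ℂ → List ℂ → ℂ
  | _, [] => 0
  | a, b :: l => Complex.log ((b - q) / (a - q)) + windingSum q b l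

theorem windingSum_append (q a c : ℂ) (l l' : List ℂ) :
    windingSum q a (l ++ c :: l') = windingSum q a (l ++ [c]) + windingSum q c l' := by
  induction l generalizing a with
  | nil => simp [windingSum]
  | cons b l ih => simp [windingSum, ih b, add_assoc]

theorem div_mem_slitPlane_of_notMem_segment {a b q : ℂ} (h : q ∉ segment ℝ a b) :
    (b - q) / (a - q) ∈ Complex.slitPlane := by
  by_contra hs
  rw [Complex.mem_slitPlane_iff_not_le_zero, not_not, Complex.le_def] at hs
  have haq : a - q ≠ 0 := by
    intro h0
    exact h (by rw [← sub_eq_zero.1 h0]; exact left_mem_segment ℝ a b)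
  set s : ℝ := -((b - q) / (a - q)).re with hs'
  have hs0 : 0 ≤ s := by simpa [s] using hs.1
  have hr : (b - q) / (a - q) = -(s : ℂ) := by
    apply Complex.ext
    · simp [s]
    · simpa using hs.2
  rw [div_eq_iff haq] at hr
  have hpos : (0 : ℝ) < 1 + s := by linarith
  apply h
  refine ⟨s / (1 + s), 1 / (1 + s), by positivity, by positivity, by field_simp; ring, ?_⟩
  have hne : (1 + s : ℂ) ≠ 0 := by exact_mod_cast hpos.ne'
  simp only [Complex.real_smul]
  push_cast
  field_simp
  linear_combination hr

theorem exp_windingSum {q a : ℂ} {l : List ℂ}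
    (h : List.IsChain (fun x y => q ∉ segment ℝ x y) (a :: l)) (ha : a ≠ q) :
    Complex.exp (windingSum q a l) =
      ((a :: l).getLast (List.cons_ne_nil a l) - q) / (a - q) := by
  have haq : a - q ≠ 0 := sub_ne_zero.2 ha
  induction l generalizing a with
  | nil => simp [windingSum, div_self haq]
  | cons b l ih =>
    rw [List.isChain_cons_cons] at h
    have hb : b ≠ q := by
      rintro rfl
      exact h.1 (right_mem_segment ℝ a b)
    have hbq : b - q ≠ 0 := sub_ne_zero.2 hb
    rw [windingSum, Complex.exp_add, Complex.exp_log (div_ne_zero hbq haq), ih h.2 hb hbq]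
    rw [List.getLast_cons (List.cons_ne_nil b l)]
    field_simp

theorem continuousOn_windingSum {T : Set ℂ} {a : ℂ} {l : List ℂ}
    (h : List.IsChain (fun x y => Disjoint (segment ℝ x y) T) (a :: l)) :
    ContinuousOn (fun q => windingSum q a l) T := by
  induction l generalizing a with
  | nil => simpa [windingSum] using continuousOn_const
  | cons b l ih =>
    rw [List.isChain_cons_cons] at h
    simp only [windingSum]
    refine ContinuousOn.add ?_ (ih h.2)
    refine ContinuousOn.clog ?_ fun q hq =>
      div_mem_slitPlane_of_notMem_segment fun hq' => h.1.notMem_of_mem_left hq' hq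
    refine ContinuousOn.div (by fun_prop) (by fun_prop) fun q hq => ?_
    intro h0
    rw [sub_eq_zero] at h0
    exact h.1.notMem_of_mem_left (left_mem_segment ℝ a b) (h0 ▸ hq)

theorem tendsto_windingSum_cobounded (a : ℂ) (l : List ℂ) :
    Tendsto (fun q => windingSum q a l) (Bornology.cobounded ℂ) (𝓝 0) := by
  induction l generalizing a with
  | nil => simp [windingSum]
  | cons b l ih =>
    simp only [windingSum]
    rw [← add_zero (0 : ℂ)]
    refine Tendsto.add ?_ (ih b)
    have h1 : Tendsto (fun q : ℂ => (a - q)⁻¹) (Bornology.cobounded ℂ) (𝓝 0) := by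
      refine tendsto_inv₀_cobounded.comp ?_
      exact tendsto_const_sub_cobounded a
    have h2 : Tendsto (fun q : ℂ => 1 + (b - a) * (a - q)⁻¹) (Bornology.cobounded ℂ) (𝓝 1) := by
      simpa using (h1.const_mul (b - a)).const_add 1
    have h3 : Tendsto (fun q : ℂ => (b - q) / (a - q)) (Bornology.cobounded ℂ) (𝓝 1) := by
      refine h2.congr' ?_
      have : ∀ᶠ q in Bornology.cobounded ℂ, q ≠ a := by
        have := Bornology.isBounded_def.1 (Bornology.isBounded_singleton : Bornology.IsBounded {a})
        filter_upwards [this] with q hq using hq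
      filter_upwards [this] with q hq
      have : a - q ≠ 0 := sub_ne_zero.2 (Ne.symm hq)
      field_simp
      ring
    have := (continuousAt_clog (x := 1) (by simp)).tendsto.comp h3
    simpa [Function.comp_def] using this

/-- A closed polygonal path winds trivially around the points of an unbounded connected set
that it does not meet. -/
theorem windingSum_eq_zero {T : Set ℂ} (hT : IsPreconnected T) (hTb : ¬ Bornology.IsBounded T)
    {a : ℂ} {l : List ℂ}
    (h : List.IsChain (fun x y => Disjoint (segment ℝ x y) T) (a :: l)) (haT : a ∉ T)
    (hcl : (a :: l).getLast (List.cons_ne_nil a l) = a) {q : ℂ} (hq : q ∈ T) :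
    windingSum q a l = 0 := by
  have hint : ∀ q ∈ T, ∃ n : ℤ, windingSum q a l = n * (2 * Real.pi * Complex.I) := by
    intro q hq
    rw [← Complex.exp_eq_one_iff, exp_windingSum (a := a) (l := l) _ _, hcl, div_self]
    · rw [sub_ne_zero]; rintro rfl; exact haT hq
    · exact h.imp fun x y hxy hq' => hxy.notMem_of_mem_left hq' hq
    · rintro rfl; exact haT hq
  have hc := continuousOn_windingSum h
  have hpi := Real.pi_pos
  -- the value is constant on `T`
  have hconst : ∀ q' ∈ T, windingSum q' a l = windingSum q a l := by
    intro q' hq'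
    obtain ⟨n, hn⟩ := hint q hq
    obtain ⟨m, hm⟩ := hint q' hq'
    have hci : ContinuousOn (fun q => (windingSum q a l).im / (2 * Real.pi)) T :=
      (Complex.continuous_im.comp_continuousOn hc).div_const _
    have hval : ∀ q ∈ T, ∀ n : ℤ, windingSum q a l = n * (2 * Real.pi * Complex.I) →
        (windingSum q a l).im / (2 * Real.pi) = n := by
      intro q _ n hn
      rw [hn]
      simp
    have himg := hT.image _ hci
    have key : ∀ m n : ℤ, (m : ℝ) ∈ (fun q => (windingSum q a l).im / (2 * Real.pi)) '' T →
        (n : ℝ) ∈ (fun q => (windingSum q a l).im / (2 * Real.pi)) '' T → m ≤ n := by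
      intro m n hm hn
      by_contra hlt
      push Not at hlt
      have hlt' : (n : ℝ) + 1 ≤ m := by exact_mod_cast hlt
      have : (n : ℝ) + 1 / 2 ∈ (fun q => (windingSum q a l).im / (2 * Real.pi)) '' T :=
        himg.ordConnected.out hn hm ⟨by linarith, by linarith⟩
      obtain ⟨x, hx, hx'⟩ := this
      obtain ⟨k, hk⟩ := hint x hx
      have h1 := hval x hx k hk
      simp only at hx'
      rw [h1] at hx'
      have h2 : ((2 * k : ℤ) : ℝ) = ((2 * n + 1 : ℤ) : ℝ) := by push_cast; linarith
      have h3 : 2 * k = 2 * n + 1 := by exact_mod_cast h2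
      omega
    have hn' : (n : ℝ) ∈ (fun q => (windingSum q a l).im / (2 * Real.pi)) '' T :=
      ⟨q, hq, hval q hq n hn⟩
    have hm' : (m : ℝ) ∈ (fun q => (windingSum q a l).im / (2 * Real.pi)) '' T :=
      ⟨q', hq', hval q' hq' m hm⟩
    rw [hn, hm, le_antisymm (key m n hm' hn') (key n m hn' hm')]
  have hne : (Bornology.cobounded ℂ ⊓ 𝓟 T).NeBot := by
    rw [inf_principal_neBot_iff]
    intro s hs
    by_contra hemp
    rw [not_nonempty_iff_eq_empty] at hemp
    apply hTb
    rw [Bornology.isBounded_def]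
    filter_upwards [hs] with x hx hxT
    exact (hemp ▸ ⟨hx, hxT⟩ : x ∈ (∅ : Set ℂ))
  have h1 : Tendsto (fun q => windingSum q a l) (Bornology.cobounded ℂ ⊓ 𝓟 T) (𝓝 0) :=
    (tendsto_windingSum_cobounded a l).mono_left inf_le_left
  have h2 : Tendsto (fun q => windingSum q a l) (Bornology.cobounded ℂ ⊓ 𝓟 T)
      (𝓝 (windingSum q a l)) := by
    refine tendsto_const_nhds.congr' ?_
    filter_upwards [mem_inf_of_right (mem_principal_self T)] with x hx using (hconst x hx).symm
  exact tendsto_nhds_unique h2 h1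

theorem log_div_im_pos {z w : ℂ} (h : z.re * w.im < z.im * w.re) : 0 < (Complex.log (z / w)).im := by
  have hw : w ≠ 0 := by rintro rfl; simp at h
  have hn : 0 < Complex.normSq w := Complex.normSq_pos.2 hw
  have him : 0 < (z / w).im := by
    rw [Complex.div_im, ← sub_div]
    exact div_pos (by linarith) hn
  rw [Complex.log_im]
  refine lt_of_le_of_ne (Complex.arg_nonneg_iff.2 him.le) fun h0 => ?_
  have := Complex.arg_eq_zero_iff.1 h0.symm
  exact him.ne' this.2

theorem log_div_im_neg {z w : ℂ} (h : z.im * w.re < z.re * w.im) : (Complex.log (z / w)).im < 0 := by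
  have hw : w ≠ 0 := by rintro rfl; simp at h
  have hn : 0 < Complex.normSq w := Complex.normSq_pos.2 hw
  have him : (z / w).im < 0 := by
    rw [Complex.div_im, ← sub_div]
    exact div_neg_of_neg_of_pos (by linarith) hn
  rw [Complex.log_im]
  exact Complex.arg_neg_iff.2 him

/-- Every point outside `G` can be joined to `∞` outside `G`. -/
def HasUnboundedComplement (G : Set ℂ) : Prop :=
  ∀ p ∉ G, ∃ T : Set ℂ, T ⊆ Gᶜ ∧ IsPreconnected T ∧ ¬ Bornology.IsBounded T ∧ p ∈ T

/-- The vertices `u` and `v` of the square lattice are equal or adjacent. -/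
def LatticeNear (u v : ℕ × ℕ) : Prop :=
  (u.1 = v.1 ∧ u.2 ≤ v.2 + 1 ∧ v.2 ≤ u.2 + 1) ∨ (u.2 = v.2 ∧ u.1 ≤ v.1 + 1 ∧ v.1 ≤ u.1 + 1)

/-- The Gaussian integer with the given coordinates. -/
def latticePoint (u : ℕ × ℕ) : ℂ := ⟨u.1, u.2⟩

/-- `u` and `v` are equal or adjacent, and the edge between them lies in `G`. -/
def LatticeEdgeIn (G : Set ℂ) (u v : ℕ × ℕ) : Prop :=
  LatticeNear u v ∧ segment ℝ (latticePoint u) (latticePoint v) ⊆ G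

theorem segment_re_im {x y z : ℂ} (hz : z ∈ segment ℝ x y) :
    ∃ s t : ℝ, 0 ≤ s ∧ 0 ≤ t ∧ s + t = 1 ∧ z.re = s * x.re + t * y.re ∧
      z.im = s * x.im + t * y.im := by
  obtain ⟨s, t, hs, ht, hst, rfl⟩ := hz
  exact ⟨s, t, hs, ht, hst, by simp, by simp⟩

theorem LatticeNear.not_mem_openSquare {u v : ℕ × ℕ} (h : LatticeNear u v) {i j : ℕ} {z : ℂ}
    (hz : z ∈ segment ℝ (latticePoint u) (latticePoint v)) (hr : (i : ℝ) < z.re)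
    (hr' : z.re < i + 1) (hi : (j : ℝ) < z.im) (hi' : z.im < j + 1) : False := by
  obtain ⟨s, t, hs, ht, hst, h1, h2⟩ := segment_re_im hz
  simp only [latticePoint] at h1 h2
  rcases h with ⟨h, -⟩ | ⟨h, -⟩
  · have : z.re = v.1 := by rw [h1, h, ← add_mul, hst, one_mul]
    rw [this] at hr hr'
    have a1 : i < v.1 := by exact_mod_cast hr
    have a2 : v.1 < i + 1 := by exact_mod_cast hr'
    omega
  · have : z.im = v.2 := by rw [h2, h, ← add_mul, hst, one_mul]
    rw [this] at hi hi'
    have a1 : j < v.2 := by exact_mod_cast hi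
    have a2 : v.2 < j + 1 := by exact_mod_cast hi'
    omega

/-- Points above the middle of the edge ending at the top right vertex `(i + 1, j + 1)` are not on
edges between other vertices. -/
theorem LatticeNear.not_mem_ray {u v : ℕ × ℕ} (h : LatticeNear u v) {i j : ℕ} {z : ℂ}
    (hv : v.2 < j + 1 ∨ v.2 = j + 1 ∧ v.1 ≤ i + 1)
    (hu' : u ≠ (i + 1, j + 1)) (hv' : v ≠ (i + 1, j + 1))
    (hz : z ∈ segment ℝ (latticePoint u) (latticePoint v)) (hr : (i : ℝ) < z.re)
    (hr' : z.re < i + 1) (hi : (j : ℝ) < z.im) : False := by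
  obtain ⟨s, t, hs, ht, hst, h1, h2⟩ := segment_re_im hz
  simp only [latticePoint] at h1 h2
  rcases h with ⟨h, -⟩ | ⟨h, h3, h4⟩
  · have : z.re = v.1 := by rw [h1, h, ← add_mul, hst, one_mul]
    rw [this] at hr hr'
    have a1 : i < v.1 := by exact_mod_cast hr
    have a2 : v.1 < i + 1 := by exact_mod_cast hr'
    omega
  · have h5 : z.im = v.2 := by rw [h2, h, ← add_mul, hst, one_mul]
    rw [h5] at hi
    have a1 : j < v.2 := by exact_mod_cast hi
    have hu1 : u.1 ≠ i + 1 := fun h => hu' (Prod.ext h (by simp; omega))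
    have hv1 : v.1 ≠ i + 1 := fun h => hv' (Prod.ext h (by simp; omega))
    have b1 : u.1 ≤ i := by omega
    have b2 : v.1 ≤ i := by omega
    have c1 : (u.1 : ℝ) ≤ i := by exact_mod_cast b1
    have c2 : (v.1 : ℝ) ≤ i := by exact_mod_cast b2
    nlinarith [mul_le_mul_of_nonneg_left c1 hs, mul_le_mul_of_nonneg_left c2 ht]

theorem HasUnboundedComplement.square_subset {G : Set ℂ} (hG : HasUnboundedComplement G)
    {i j : ℕ} {b c : ℕ × ℕ} {k : List (ℕ × ℕ)}
    (hbc : (b = (i, j + 1) ∧ c = (i + 1, j)) ∨ (b = (i + 1, j) ∧ c = (i, j + 1)))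
    (hab : LatticeEdgeIn G (i + 1, j + 1) b) (hca : LatticeEdgeIn G c (i + 1, j + 1))
    (hk : List.IsChain (LatticeEdgeIn G) (b :: (k ++ [c])))
    (hmax : ∀ v ∈ b :: (k ++ [c]), v.2 < j + 1 ∨ v.2 = j + 1 ∧ v.1 ≤ i + 1)
    (hne : ∀ v ∈ b :: (k ++ [c]), v ≠ (i + 1, j + 1)) :
    Icc (i : ℝ) (i + 1) ×ℂ Icc (j : ℝ) (j + 1) ⊆ G := by
  intro p hp
  by_contra hpG
  obtain ⟨T, hTG, hT, hTb, hpT⟩ := hG p hpG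
  rw [Complex.mem_reProdIm] at hp
  obtain ⟨⟨hp1, hp2⟩, hp3, hp4⟩ := hp
  set q : ℂ := ⟨i + 3 / 4, j + 3 / 4⟩ with hq
  set a : ℕ × ℕ := (i + 1, j + 1) with ha
  -- the closed walk avoids `T` and a segment joining `p` to `q`
  have hseg : ∀ u v, LatticeEdgeIn G u v →
      Disjoint (segment ℝ (latticePoint u) (latticePoint v)) (T ∪ segment ℝ p q) := by
    intro u v huv
    rw [Set.disjoint_union_right]
    refine ⟨Set.disjoint_left.2 fun z hz hzT => hTG hzT (huv.2 hz), ?_⟩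
    refine Set.disjoint_left.2 fun z hz hzT => ?_
    obtain ⟨s, t, hs, ht, hst, h1, h2⟩ := segment_re_im hzT
    rcases ht.eq_or_lt with h0 | h0
    · have hs1 : s = 1 := by linarith
      subst h0 hs1
      have : z = p := Complex.ext (by simpa using h1) (by simpa using h2)
      exact hpG (huv.2 (this ▸ hz))
    · simp only [hq] at h1 h2
      refine huv.1.not_mem_openSquare (i := i) (j := j) hz ?_ ?_ ?_ ?_ <;> nlinarith
  have hT' : IsPreconnected (T ∪ segment ℝ p q) :=
    IsPreconnected.union p hpT (left_mem_segment ℝ p q) hT (convex_segment p q).isPreconnected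
  have hTb' : ¬ Bornology.IsBounded (T ∪ segment ℝ p q) := fun h =>
    hTb (h.subset subset_union_left)
  have hchain : List.IsChain (LatticeEdgeIn G) (a :: (b :: (k ++ [c, a]))) := by
    rw [List.isChain_cons_cons]
    refine ⟨hab, ?_⟩
    rw [List.isChain_cons_append_cons_cons]
    exact ⟨hk, hca, List.isChain_singleton a⟩
  have hA := windingSum_eq_zero hT' hTb' (a := latticePoint a)
    (l := latticePoint b :: (k.map latticePoint ++ [latticePoint c, latticePoint a])) (q := q)
    (by
      have := (List.isChain_map latticePoint (l := a :: (b :: (k ++ [c, a])))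
        (R := fun x y => Disjoint (segment ℝ x y) (T ∪ segment ℝ p q))).2
        (hchain.imp fun u v => hseg u v)
      simpa using this)
    (fun h => (hseg _ _ hab).notMem_of_mem_left (left_mem_segment ℝ _ _) h)
    (by simp)
    (Or.inr (right_mem_segment ℝ p q))
  -- closing the walk up by the diagonal, it avoids the vertical ray above `q`
  set S : Set ℂ := {z | z.re = i + 3 / 4 ∧ (j : ℝ) + 3 / 4 ≤ z.im} with hS
  have hSc : IsPreconnected S := by
    refine Convex.isPreconnected ?_
    intro x hx y hy s t hs ht hst
    simp only [hS, Set.mem_ofPred_eq, Complex.add_re, Complex.real_smul, Complex.mul_re,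
      Complex.ofReal_re, Complex.ofReal_im, zero_mul, sub_zero, Complex.add_im, Complex.mul_im,
      add_zero] at hx hy ⊢
    refine ⟨by rw [hx.1, hy.1, ← add_mul, hst, one_mul], ?_⟩
    nlinarith [mul_le_mul_of_nonneg_left hx.2 hs, mul_le_mul_of_nonneg_left hy.2 ht]
  have hSb : ¬ Bornology.IsBounded S := by
    intro h
    obtain ⟨M, hM⟩ := isBounded_iff_forall_norm_le.1 h
    have h1 := hM ⟨i + 3 / 4, j + 3 / 4 + |M| + 1⟩
      ⟨rfl, by have := abs_nonneg M; simp; linarith⟩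
    have h2 := Complex.abs_im_le_norm (⟨i + 3 / 4, j + 3 / 4 + |M| + 1⟩ : ℂ)
    simp only at h2
    have h3 := le_abs_self ((j : ℝ) + 3 / 4 + |M| + 1)
    have h4 := le_abs_self M
    have h5 : (0 : ℝ) ≤ j := Nat.cast_nonneg j
    linarith
  have hdiag : Disjoint (segment ℝ (latticePoint c) (latticePoint b)) S := by
    refine Set.disjoint_left.2 fun z hz hzS => ?_
    obtain ⟨s, t, hs, ht, hst, h1, h2⟩ := segment_re_im hz
    obtain ⟨h3, h4⟩ := hzS
    rcases hbc with ⟨rfl, rfl⟩ | ⟨rfl, rfl⟩ <;>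
    · simp only [latticePoint] at h1 h2
      push_cast at h1 h2
      nlinarith
  have hrayseg : ∀ u v, (LatticeEdgeIn G u v ∧ u ∈ b :: (k ++ [c]) ∧ v ∈ b :: (k ++ [c])) →
      Disjoint (segment ℝ (latticePoint u) (latticePoint v)) S := by
    rintro u v ⟨huv, hu, hv⟩
    refine Set.disjoint_left.2 fun z hz hzS => ?_
    obtain ⟨h3, h4⟩ := hzS
    exact huv.1.not_mem_ray (hmax v hv) (hne u hu) (hne v hv) hz (by linarith)
      (by linarith) (by linarith)
  have hB := windingSum_eq_zero hSc hSb (a := latticePoint b)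
    (l := k.map latticePoint ++ [latticePoint c, latticePoint b]) (q := q)
    (by
      rw [List.isChain_cons_append_cons_cons]
      refine ⟨?_, hdiag, List.isChain_singleton _⟩
      have h1 : List.IsChain (fun u v => LatticeEdgeIn G u v ∧ u ∈ b :: (k ++ [c]) ∧
          v ∈ b :: (k ++ [c])) (b :: (k ++ [c])) := by
        rw [List.isChain_iff_getElem] at hk ⊢
        intro n hn
        exact ⟨hk n hn, List.getElem_mem _, List.getElem_mem _⟩
      have := (List.isChain_map latticePoint (l := b :: (k ++ [c]))
        (R := fun x y => Disjoint (segment ℝ x y) S)).2 (h1.imp fun u v => hrayseg u v)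
      simpa using this)
    (fun h => hdiag.notMem_of_mem_left (right_mem_segment ℝ _ _) h)
    (by simp)
    (by simp [hS, hq])
  rw [windingSum, windingSum_append] at hA
  rw [windingSum_append] at hB
  simp only [windingSum, add_zero] at hA hB
  have hrel : Complex.log ((latticePoint b - q) / (latticePoint a - q)) +
      Complex.log ((latticePoint a - q) / (latticePoint c - q)) =
      Complex.log ((latticePoint b - q) / (latticePoint c - q)) := by
    linear_combination hA - hB
  have him := congrArg Complex.im hrel
  rw [Complex.add_im] at him
  rcases hbc with ⟨rfl, rfl⟩ | ⟨rfl, rfl⟩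
  · have e1 := log_div_im_pos (z := latticePoint (i, j + 1) - q) (w := latticePoint a - q)
      (by simp [latticePoint, hq, ha]; norm_num)
    have e2 := log_div_im_pos (z := latticePoint a - q) (w := latticePoint (i + 1, j) - q)
      (by simp [latticePoint, hq, ha]; norm_num)
    have e3 := log_div_im_neg (z := latticePoint (i, j + 1) - q)
      (w := latticePoint (i + 1, j) - q)
      (by simp [latticePoint, hq]; norm_num)
    linarith
  · have e1 := log_div_im_neg (z := latticePoint (i + 1, j) - q) (w := latticePoint a - q)
      (by simp [latticePoint, hq, ha]; norm_num)
    have e2 := log_div_im_neg (z := latticePoint a - q) (w := latticePoint (i, j + 1) - q)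
      (by simp [latticePoint, hq, ha]; norm_num)
    have e3 := log_div_im_pos (z := latticePoint (i + 1, j) - q)
      (w := latticePoint (i, j + 1) - q)
      (by simp [latticePoint, hq]; norm_num)
    linarith

/-- The product of the values of `e` along the edges of the walk with vertices `a` and `l`. -/
def walkProd {α π : Type*} [Group π] (e : α → α → π) : α → List α → π
  | _, [] => 1
  | a, b :: l => e a b * walkProd e b l

theorem walkProd_append {α π : Type*} [Group π] (e : α → α → π) (a c : α) (l l' : List α) :
    walkProd e a (l ++ c :: l') = walkProd e a (l ++ [c]) * walkProd e c l' := by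
  induction l generalizing a with
  | nil => simp [walkProd]
  | cons b l ih => simp [walkProd, ih b, mul_assoc]

/-- `e` is multiplicative on triangles contained in convex subsets of `G`. -/
def IsLocalCocycle {π : Type*} [Group π] (G : Set ℂ) (e : ℂ → ℂ → π) : Prop :=
  ∀ K ⊆ G, Convex ℝ K → ∀ x ∈ K, ∀ y ∈ K, ∀ z ∈ K, e x y * e y z = e x z

theorem square_corners_mem (i j : ℕ) (u : ℕ × ℕ) (h1 : i ≤ u.1) (h2 : u.1 ≤ i + 1) (h3 : j ≤ u.2)
    (h4 : u.2 ≤ j + 1) : latticePoint u ∈ Icc (i : ℝ) (i + 1) ×ℂ Icc (j : ℝ) (j + 1) := by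
  rw [Complex.mem_reProdIm]
  simp only [latticePoint, mem_Icc]
  refine ⟨⟨?_, ?_⟩, ?_, ?_⟩ <;> assumption_mod_cast

theorem convex_square (i j : ℕ) : Convex ℝ (Icc (i : ℝ) (i + 1) ×ℂ Icc (j : ℝ) (j + 1)) :=
  ((convex_Icc (i : ℝ) (i + 1)).linear_preimage Complex.reLm).inter
    ((convex_Icc (j : ℝ) (j + 1)).linear_preimage Complex.imLm)

theorem exists_topRight {s : List (ℕ × ℕ)} (hs : s ≠ []) :
    ∃ x ∈ s, ∀ v ∈ s, v.2 < x.2 ∨ v.2 = x.2 ∧ v.1 ≤ x.1 := by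
  classical
  obtain ⟨x, hx, hmax⟩ := Finset.exists_max_image s.toFinset
    (fun u => (toLex (u.2, u.1) : ℕ ×ₗ ℕ)) (by simpa using hs)
  refine ⟨x, by simpa using hx, fun v hv => ?_⟩
  have := hmax v (by simpa using hv)
  simpa [Prod.Lex.le_iff] using this

theorem exists_eq_append_of_not_nodup {α : Type*} {m : List α} (h : ¬ m.Nodup) :
    ∃ s x t u, m = s ++ x :: (t ++ x :: u) := by
  induction m with
  | nil => simp at h
  | cons b m ih =>
    by_cases hb : b ∈ m
    · obtain ⟨t, u, rfl⟩ := List.append_of_mem hb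
      exact ⟨[], b, t, u, rfl⟩
    · have : ¬ m.Nodup := fun hm => h (List.nodup_cons.2 ⟨hb, hm⟩)
      obtain ⟨s, x, t, u, rfl⟩ := ih this
      exact ⟨b :: s, x, t, u, rfl⟩

theorem LatticeNear.eq_corners {a b c : ℕ × ℕ} (hab : LatticeNear a b) (hca : LatticeNear c a)
    (hb : b.2 < a.2 ∨ b.2 = a.2 ∧ b.1 ≤ a.1) (hc : c.2 < a.2 ∨ c.2 = a.2 ∧ c.1 ≤ a.1)
    (hba : b ≠ a) (hac : c ≠ a) (hbc : b ≠ c) :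
    ∃ i j, a = (i + 1, j + 1) ∧
      ((b = (i, j + 1) ∧ c = (i + 1, j)) ∨ (b = (i + 1, j) ∧ c = (i, j + 1))) := by
  obtain ⟨a1, a2⟩ := a
  obtain ⟨b1, b2⟩ := b
  obtain ⟨c1, c2⟩ := c
  simp only [LatticeNear, Prod.mk.injEq, ne_eq] at *
  have hb' : (b1 = a1 ∧ b2 + 1 = a2) ∨ (b1 + 1 = a1 ∧ b2 = a2) := by omega
  have hc' : (c1 = a1 ∧ c2 + 1 = a2) ∨ (c1 + 1 = a1 ∧ c2 = a2) := by omega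
  clear hab hca hb hc hba hac
  rcases hb' with ⟨rfl, rfl⟩ | ⟨rfl, rfl⟩ <;> rcases hc' with ⟨h1, h2⟩ | ⟨h1, h2⟩
  · omega
  · subst h1
    exact ⟨c1, b2, by simp, Or.inr (by simp [h2])⟩
  · subst h2
    exact ⟨b1, c2, by simp, Or.inl (by simp [h1])⟩
  · omega

/-- A local cocycle is trivial along closed lattice walks in a set with unbounded complement. -/
theorem walkProd_closed_eq_one {π : Type*} [Group π] {G : Set ℂ} (hG : HasUnboundedComplement G)
    {e : ℂ → ℂ → π} (he : IsLocalCocycle G e) (a : ℕ × ℕ) (m : List (ℕ × ℕ))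
    (hm : List.IsChain (LatticeEdgeIn G) (a :: (m ++ [a]))) :
    walkProd (fun u v => e (latticePoint u) (latticePoint v)) a (m ++ [a]) = 1 := by
  set E : ℕ × ℕ → ℕ × ℕ → π := fun u v => e (latticePoint u) (latticePoint v) with hE
  have hEtri : ∀ K ⊆ G, Convex ℝ K → ∀ u v w, latticePoint u ∈ K → latticePoint v ∈ K →
      latticePoint w ∈ K → E u v * E v w = E u w :=
    fun K hK hc u v w hu hv hw => he K hK hc _ hu _ hv _ hw
  have hEself : ∀ u, latticePoint u ∈ G → E u u = 1 := by
    intro u hu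
    have := hEtri {latticePoint u} (by simpa using hu) (convex_singleton _) u u u rfl rfl rfl
    simpa using this
  have hEinv : ∀ u v, LatticeEdgeIn G u v → E u v * E v u = 1 := by
    intro u v huv
    rw [hEtri _ huv.2 (convex_segment _ _) u v u (left_mem_segment ℝ _ _)
      (right_mem_segment ℝ _ _) (left_mem_segment ℝ _ _)]
    exact hEself u (huv.2 (left_mem_segment ℝ _ _))
  obtain ⟨n, hn⟩ : ∃ n, m.length = n := ⟨_, rfl⟩
  induction n using Nat.strong_induction_on generalizing a m with
  | _ n ihn =>
  obtain ⟨w, hw⟩ : ∃ w, a.1 + a.2 + (m.map fun u => u.1 + u.2).sum = w := ⟨_, rfl⟩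
  induction w using Nat.strong_induction_on generalizing a m with
  | _ w ihw =>
  by_cases hnd : (a :: m).Nodup
  swap
  · by_cases ham : a ∈ m
    · obtain ⟨s, t, rfl⟩ := List.append_of_mem ham
      simp only [List.append_assoc, List.cons_append, List.length_append, List.length_cons] at hm hn ⊢
      rw [walkProd_append]
      rw [← List.cons_append, List.isChain_split] at hm
      rw [ihn s.length (by omega) a s hm.1 rfl, ihn t.length (by omega) a t hm.2 rfl, one_mul]
    · have : ¬ m.Nodup := fun h => hnd (List.nodup_cons.2 ⟨ham, h⟩)
      obtain ⟨s, x, t, u, rfl⟩ := exists_eq_append_of_not_nodup this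
      simp only [List.append_assoc, List.cons_append, List.length_append, List.length_cons]
        at hm hn ⊢
      rw [walkProd_append, walkProd_append _ x x t]
      rw [← List.cons_append, List.isChain_split] at hm
      obtain ⟨h1, h23⟩ := hm
      obtain ⟨h2, h3⟩ := List.isChain_split (l₁ := x :: t).1 h23
      rw [ihn t.length (by omega) x t h2 rfl, one_mul, ← walkProd_append]
      have h4 : List.IsChain (LatticeEdgeIn G) (a :: ((s ++ x :: u) ++ [a])) := by
        simp only [List.append_assoc, List.cons_append]
        rw [← List.cons_append, List.isChain_split]
        exact ⟨h1, h3⟩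
      have := ihn (s ++ x :: u).length (by simp; omega) a (s ++ x :: u) h4 rfl
      simpa using this
  -- the walk is simple; first reduce to the case where it starts at its top right vertex
  suffices key : ∀ (a : ℕ × ℕ) (m : List (ℕ × ℕ)),
      List.IsChain (LatticeEdgeIn G) (a :: (m ++ [a])) → m.length = n →
      a.1 + a.2 + (m.map fun u => u.1 + u.2).sum = w → (a :: m).Nodup →
      (∀ v ∈ m, v.2 < a.2 ∨ v.2 = a.2 ∧ v.1 ≤ a.1) → walkProd E a (m ++ [a]) = 1 by
    obtain ⟨x, hx, hmax⟩ := exists_topRight (List.cons_ne_nil a m)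
    rcases List.mem_cons.1 hx with rfl | hxm
    · exact key x m hm hn hw hnd fun v hv => hmax v (List.mem_cons_of_mem _ hv)
    · obtain ⟨s, u, rfl⟩ := List.append_of_mem hxm
      simp only [List.append_assoc, List.cons_append] at hm ⊢
      rw [← List.cons_append, List.isChain_split] at hm
      have hperm : (x :: (u ++ a :: s)).Perm (a :: (s ++ x :: u)) := by
        have h1 : (x :: u ++ a :: s).Perm (a :: s ++ x :: u) := List.perm_append_comm
        simpa using h1
      have h2 := key x (u ++ a :: s)
        (by
          simp only [List.append_assoc, List.cons_append]
          rw [← List.cons_append, List.isChain_split]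
          exact ⟨hm.2, hm.1⟩)
        (by simpa [add_comm, add_left_comm, add_assoc] using hn)
        (by
          have := (hperm.map fun u => u.1 + u.2).sum_eq
          simp only [List.map_cons, List.sum_cons] at this
          rw [this]; exact hw)
        (hperm.nodup_iff.2 hnd)
        (fun v hv => hmax v (hperm.mem_iff.1 (List.mem_cons_of_mem _ hv)))
      simp only [List.append_assoc, List.cons_append] at h2
      rw [walkProd_append] at h2 ⊢
      rw [mul_eq_one_iff_eq_inv] at h2 ⊢
      rw [h2, inv_inv]
  clear hm hn hw hnd a m
  intro a m hm hn hw hnd hmax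
  rcases m with _ | ⟨b, m⟩
  · have h1 : LatticeEdgeIn G a a := by simpa using hm
    simp [walkProd, hEself a (h1.2 (left_mem_segment ℝ _ _))]
  rcases List.eq_nil_or_concat m with rfl | ⟨k, c, rfl⟩
  · have h1 : LatticeEdgeIn G a b := by
      simp only [List.cons_append, List.isChain_cons_cons] at hm
      exact hm.1
    simpa [walkProd] using hEinv a b h1
  simp only [List.concat_eq_append, List.append_assoc, List.cons_append, List.nil_append]
    at hm hn hw hnd hmax ⊢
  have hab : LatticeEdgeIn G a b := (List.isChain_cons_cons.1 hm).1
  have hrest := (List.isChain_cons_cons.1 hm).2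
  rw [List.isChain_cons_append_cons_cons] at hrest
  obtain ⟨hk, hca, -⟩ := hrest
  have hne : ∀ v ∈ b :: (k ++ [c]), v ≠ a := fun v hv h =>
    (List.nodup_cons.1 hnd).1 (h ▸ hv)
  have hbc : b ≠ c := by
    rintro rfl
    simp at hnd
  have hb := hmax b (by simp)
  have hc := hmax c (by simp)
  have hab' := hne b (by simp)
  have hac' := hne c (by simp)
  obtain ⟨i, j, rfl, hcases⟩ := hab.1.eq_corners hca.1 hb hc hab' hac' hbc
  have hsq := hG.square_subset hcases hab hca hk hmax hne
  have hcorner : ∀ u : ℕ × ℕ, i ≤ u.1 → u.1 ≤ i + 1 → j ≤ u.2 → u.2 ≤ j + 1 →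
      latticePoint u ∈ Icc (i : ℝ) (i + 1) ×ℂ Icc (j : ℝ) (j + 1) := square_corners_mem i j
  have hbs : latticePoint b ∈ Icc (i : ℝ) (i + 1) ×ℂ Icc (j : ℝ) (j + 1) := by
    apply hcorner <;> rcases hcases with ⟨rfl, rfl⟩ | ⟨rfl, rfl⟩ <;> simp
  have hcs : latticePoint c ∈ Icc (i : ℝ) (i + 1) ×ℂ Icc (j : ℝ) (j + 1) := by
    apply hcorner <;> rcases hcases with ⟨rfl, rfl⟩ | ⟨rfl, rfl⟩ <;> simp
  have has := hcorner (i + 1, j + 1) (by simp) (by simp) (by simp) (by simp)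
  have hds := hcorner (i, j) (by simp) (by simp) (by simp) (by simp)
  have hedge : ∀ u v : ℕ × ℕ, LatticeNear u v →
      latticePoint u ∈ Icc (i : ℝ) (i + 1) ×ℂ Icc (j : ℝ) (j + 1) →
      latticePoint v ∈ Icc (i : ℝ) (i + 1) ×ℂ Icc (j : ℝ) (j + 1) → LatticeEdgeIn G u v :=
    fun u v huv hu hv => ⟨huv, ((convex_square i j).segment_subset hu hv).trans hsq⟩
  have hdb : LatticeEdgeIn G (i, j) b := by
    refine hedge _ _ ?_ hds hbs
    rcases hcases with ⟨rfl, rfl⟩ | ⟨rfl, rfl⟩ <;> simp [LatticeNear] <;> omega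
  have hcd : LatticeEdgeIn G c (i, j) := by
    refine hedge _ _ ?_ hcs hds
    rcases hcases with ⟨rfl, rfl⟩ | ⟨rfl, rfl⟩ <;> simp [LatticeNear] <;> omega
  -- move the corner to the opposite vertex of the square
  have hnew := ihw (w - 2) (by simp at hw; omega) (i, j) (b :: (k ++ [c]))
    (by
      simp only [List.append_assoc, List.cons_append, List.nil_append]
      rw [List.isChain_cons_cons, List.isChain_cons_append_cons_cons]
      exact ⟨hdb, hk, hcd, List.isChain_singleton _⟩)
    (by simpa using hn)
    (by simp at hw ⊢; omega)
  simp only [List.append_assoc, List.cons_append, List.nil_append, walkProd] at hnew ⊢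
  rw [walkProd_append] at hnew ⊢
  simp only [walkProd, mul_one] at hnew ⊢
  have t1 := hEtri _ hsq (convex_square i j) c (i + 1, j + 1) b hcs has hbs
  have t2 := hEtri _ hsq (convex_square i j) c (i, j) b hcs hds hbs
  have t3 : walkProd E b (k ++ [c]) * (E c (i, j) * E (i, j) b) = 1 := by
    rw [← mul_assoc]
    exact mul_eq_one_comm.1 hnew
  rw [mul_eq_one_comm, mul_assoc, t1, ← t2, t3]

theorem walkProd_append_getLast {α π : Type*} [Group π] (e : α → α → π) (a : α) (l l' : List α) :
    walkProd e a (l ++ l') =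
      walkProd e a l * walkProd e ((a :: l).getLast (List.cons_ne_nil a l)) l' := by
  induction l generalizing a with
  | nil => simp [walkProd]
  | cons b l ih =>
    rw [List.cons_append, walkProd, walkProd, ih b, mul_assoc, List.getLast_cons (List.cons_ne_nil b l)]

/-- The lattice point to the lower left of `z`. -/
def latticeFloor (z : ℂ) : ℕ × ℕ := (⌊z.re⌋₊, ⌊z.im⌋₊)

theorem floor_near {x y : ℝ} (hx : 0 ≤ x) (h : |y - x| ≤ 1) : ⌊x⌋₊ ≤ ⌊y⌋₊ + 1 := by
  rw [← Nat.lt_add_one_iff, Nat.floor_lt hx]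
  have := Nat.lt_floor_add_one y
  have := (abs_le.1 h).1
  push_cast
  linarith

theorem mem_ball_five {x y : ℂ} (h1 : |x.re - y.re| ≤ 2) (h2 : |x.im - y.im| ≤ 2) :
    x ∈ Metric.ball y 5 := by
  rw [Metric.mem_ball, dist_eq_norm]
  have := Complex.norm_le_abs_re_add_abs_im (x - y)
  simp only [Complex.sub_re, Complex.sub_im] at this
  linarith

/-- A local cocycle is trivial along closed chains of short steps. -/
theorem IsLocalCocycle.chain_eq_one {π : Type*} [Group π] {G : Set ℂ}
    (hG : HasUnboundedComplement G) {e : ℂ → ℂ → π} (he : IsLocalCocycle G e) {y : ℕ → ℂ} {N : ℕ}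
    (hre : ∀ n ≤ N, 0 ≤ (y n).re) (him : ∀ n ≤ N, 0 ≤ (y n).im)
    (hball : ∀ n ≤ N, Metric.ball (y n) 5 ⊆ G) (hstep : ∀ n < N, ‖y (n + 1) - y n‖ ≤ 1)
    (hcl : y N = y 0) {C : ℕ → π} (hC0 : C 0 = 1)
    (hC : ∀ n < N, C (n + 1) = C n * e (y n) (y (n + 1))) : C N = 1 := by
  set v : ℕ → ℕ × ℕ := fun n => latticeFloor (y n) with hv
  set E : ℕ × ℕ → ℕ × ℕ → π := fun u v => e (latticePoint u) (latticePoint v) with hE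
  have hfl : ∀ n ≤ N, |(latticePoint (v n)).re - (y n).re| ≤ 1 ∧
      |(latticePoint (v n)).im - (y n).im| ≤ 1 := by
    intro n hn
    have h1 := Nat.floor_le (hre n hn)
    have h2 := Nat.lt_floor_add_one (y n).re
    have h3 := Nat.floor_le (him n hn)
    have h4 := Nat.lt_floor_add_one (y n).im
    simp only [hv, latticeFloor, latticePoint, abs_le]
    refine ⟨⟨?_, ?_⟩, ?_, ?_⟩ <;> linarith
  have hctr : ∀ n, y n ∈ Metric.ball (y n) 5 := fun n => Metric.mem_ball_self (by norm_num)
  have hvb : ∀ n ≤ N, latticePoint (v n) ∈ Metric.ball (y n) 5 := fun n hn =>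
    mem_ball_five ((hfl n hn).1.trans (by norm_num)) ((hfl n hn).2.trans (by norm_num))
  have key : ∀ n ≤ N, ∃ l, List.IsChain (LatticeEdgeIn G) (v 0 :: l) ∧
      (v 0 :: l).getLast (List.cons_ne_nil _ l) = v n ∧
      C n = e (y 0) (latticePoint (v 0)) * walkProd E (v 0) l * e (latticePoint (v n)) (y n) := by
    intro n
    induction n with
    | zero =>
      intro hn
      refine ⟨[], by simp, by simp, ?_⟩
      have h1 := he _ (hball 0 hn) (convex_ball _ _) _ (hctr 0) _ (hvb 0 hn) _ (hctr 0)
      have h2 := he _ (hball 0 hn) (convex_ball _ _) _ (hctr 0) _ (hctr 0) _ (hctr 0)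
      rw [hC0, walkProd, mul_one, h1]
      exact (mul_eq_left.1 h2).symm
    | succ n ih =>
      intro hn
      obtain ⟨l, hl, hlast, hCn⟩ := ih (by omega)
      have hn' : n ≤ N := by omega
      have hs := hstep n hn
      have hsre : |(y (n + 1)).re - (y n).re| ≤ 1 := by
        simpa using (Complex.abs_re_le_norm (y (n + 1) - y n)).trans hs
      have hsim : |(y (n + 1)).im - (y n).im| ≤ 1 := by
        simpa using (Complex.abs_im_le_norm (y (n + 1) - y n)).trans hs
      set w : ℕ × ℕ := ((v (n + 1)).1, (v n).2) with hw
      have hv1 : |(latticePoint (v (n + 1))).re - (y n).re| ≤ 2 := by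
        have h1 := abs_le.1 (hfl (n + 1) hn).1
        have h2 := abs_le.1 hsre
        exact abs_le.2 ⟨by linarith, by linarith⟩
      have hv2 : |(latticePoint (v (n + 1))).im - (y n).im| ≤ 2 := by
        have h1 := abs_le.1 (hfl (n + 1) hn).2
        have h2 := abs_le.1 hsim
        exact abs_le.2 ⟨by linarith, by linarith⟩
      have b0 := hctr n
      have b1 := hvb n hn'
      have b2 : latticePoint w ∈ Metric.ball (y n) 5 :=
        mem_ball_five hv1 ((hfl n hn').2.trans (by norm_num))
      have b3 : latticePoint (v (n + 1)) ∈ Metric.ball (y n) 5 := mem_ball_five hv1 hv2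
      have b4 : y (n + 1) ∈ Metric.ball (y n) 5 :=
        mem_ball_five (hsre.trans (by norm_num)) (hsim.trans (by norm_num))
      have hc := convex_ball (y n) 5
      have tri := he _ (hball n hn') hc
      have hnw : LatticeNear (v n) w := by
        refine Or.inr ⟨rfl, ?_, ?_⟩
        · exact floor_near (hre n hn') hsre
        · exact floor_near (hre (n + 1) hn) (by rw [abs_sub_comm]; exact hsre)
      have hwn : LatticeNear w (v (n + 1)) := by
        refine Or.inl ⟨rfl, ?_, ?_⟩
        · exact floor_near (him n hn') hsim
        · exact floor_near (him (n + 1) hn) (by rw [abs_sub_comm]; exact hsim)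
      refine ⟨l ++ [w, v (n + 1)], ?_, by simp, ?_⟩
      · rw [← List.cons_append, List.isChain_append]
        refine ⟨hl, ?_, ?_⟩
        · simp only [List.isChain_cons_cons, List.isChain_singleton, and_true]
          exact ⟨hwn, (hc.segment_subset b2 b3).trans (hball n hn')⟩
        · intro x hx z hz
          rw [List.getLast?_eq_getLast_of_ne_nil (List.cons_ne_nil _ l), hlast] at hx
          simp only [Option.mem_def, Option.some.injEq, List.head?_cons] at hx hz
          rw [← hx, ← hz]
          exact ⟨hnw, (hc.segment_subset b1 b2).trans (hball n hn')⟩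
      · rw [hC n hn, hCn, walkProd_append_getLast, hlast]
        simp only [walkProd, mul_one, hE]
        rw [tri _ b1 _ b2 _ b3]
        simp only [mul_assoc]
        rw [tri _ b1 _ b0 _ b4, tri _ b1 _ b3 _ b4]
  obtain ⟨l, hl, hlast, hCN⟩ := key N le_rfl
  have hvN : v N = v 0 := by simp only [hv, hcl]
  have hw1 : walkProd E (v 0) l = 1 := by
    rcases List.eq_nil_or_concat l with rfl | ⟨m, b, rfl⟩
    · rfl
    · rw [List.concat_eq_append] at *
      have : b = v 0 := by simpa [hvN] using hlast
      subst this
      exact walkProd_closed_eq_one hG he _ m hl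
  have h0 : 0 ≤ N := Nat.zero_le N
  rw [hCN, hw1, mul_one, hvN, hcl,
    he _ (hball 0 h0) (convex_ball _ _) _ (hctr 0) _ (hvb 0 h0) _ (hctr 0)]
  simpa using he _ (hball 0 h0) (convex_ball _ _) _ (hctr 0) _ (hctr 0) _ (hctr 0)

open unitInterval

/-- Paths with the same ends in a convex subset of `G` are homotopic in `G`. -/
theorem homotopic_of_convex {G K : Set ℂ} (hK : Convex ℝ K) (hKG : K ⊆ G) {x y : G}
    (p q : Path x y) (hp : ∀ t, (p t : ℂ) ∈ K) (hq : ∀ t, (q t : ℂ) ∈ K) : p.Homotopic q := by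
  have hx : (x : ℂ) ∈ K := by simpa using hp 0
  have hy : (y : ℂ) ∈ K := by simpa using hp 1
  have : ContractibleSpace K := hK.contractibleSpace ⟨x, hx⟩
  let p' : Path (⟨x, hx⟩ : K) ⟨y, hy⟩ :=
    { toFun := fun t => ⟨p t, hp t⟩
      continuous_toFun := by fun_prop
      source' := by simp
      target' := by simp }
  let q' : Path (⟨x, hx⟩ : K) ⟨y, hy⟩ :=
    { toFun := fun t => ⟨q t, hq t⟩
      continuous_toFun := by fun_prop
      source' := by simp
      target' := by simp }
  have h := (SimplyConnectedSpace.paths_homotopic p' q').map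
    (⟨Set.inclusion hKG, continuous_inclusion hKG⟩ : C(K, G))
  exact h

/-- The straight path between two points of `G`. -/
def segmentPath {G : Set ℂ} (x y : G) (h : segment ℝ (x : ℂ) y ⊆ G) : Path x y where
  toFun t := ⟨AffineMap.lineMap (x : ℂ) (y : ℂ) (t : ℝ), h (by
    rw [segment_eq_image_lineMap]; exact ⟨t, t.2, rfl⟩)⟩
  continuous_toFun := by
    refine Continuous.subtype_mk ?_ _
    exact AffineMap.lineMap_continuous.comp continuous_subtype_val
  source' := by simp
  target' := by simp

theorem segmentPath_mem {G : Set ℂ} (x y : G) (h : segment ℝ (x : ℂ) y ⊆ G) (t : I) :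
    (segmentPath x y h t : ℂ) ∈ segment ℝ (x : ℂ) y := by
  rw [segment_eq_image_lineMap]; exact ⟨t, t.2, rfl⟩

/-- The loop at `x₀` running to `y`, along `p`, and back. -/
def basedLoop {X : Type*} [TopologicalSpace X] [PathConnectedSpace X] (x₀ : X) {y x : X}
    (p : Path.Homotopic.Quotient y x) : FundamentalGroup X x₀ :=
  .trans (.mk (PathConnectedSpace.somePath x₀ y))
    (.trans p (.symm (.mk (PathConnectedSpace.somePath x₀ x))))

theorem basedLoop_mul {X : Type*} [TopologicalSpace X] [PathConnectedSpace X] (x₀ : X) {x y z : X}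
    (p : Path.Homotopic.Quotient y x) (q : Path.Homotopic.Quotient z y) :
    basedLoop x₀ p * basedLoop x₀ q = basedLoop x₀ (q.trans p) := by
  rw [FundamentalGroup.mul_def]
  simp only [basedLoop, Path.Homotopic.Quotient.trans_assoc]
  rw [← Path.Homotopic.Quotient.trans_assoc (Path.Homotopic.Quotient.symm _),
    Path.Homotopic.Quotient.symm_trans, Path.Homotopic.Quotient.refl_trans]

theorem basedLoop_refl {X : Type*} [TopologicalSpace X] [PathConnectedSpace X] (x₀ x : X) :
    basedLoop x₀ (.refl x) = 1 := by
  rw [FundamentalGroup.one_def, basedLoop, Path.Homotopic.Quotient.refl_trans,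
    Path.Homotopic.Quotient.trans_symm]

theorem eq_refl_of_basedLoop_eq_one {X : Type*} [TopologicalSpace X] [PathConnectedSpace X]
    (x₀ : X) {x : X} (p : Path.Homotopic.Quotient x x) (h : basedLoop x₀ p = 1) : p = .refl x := by
  rw [FundamentalGroup.one_def] at h
  simp only [basedLoop] at h
  set a := Path.Homotopic.Quotient.mk (PathConnectedSpace.somePath x₀ x)
  calc p = (a.symm.trans (a.trans (p.trans a.symm))).trans a := by
        rw [← Path.Homotopic.Quotient.trans_assoc, Path.Homotopic.Quotient.symm_trans,
          Path.Homotopic.Quotient.refl_trans, Path.Homotopic.Quotient.trans_assoc,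
          Path.Homotopic.Quotient.symm_trans, Path.Homotopic.Quotient.trans_refl]
    _ = .refl x := by
        rw [h, Path.Homotopic.Quotient.trans_refl, Path.Homotopic.Quotient.symm_trans]

open Classical in
/-- The class of the loop running along the segment from `y` to `x`. -/
def segmentClass {G : Set ℂ} [PathConnectedSpace G] (x₀ : G) (x y : ℂ) : FundamentalGroup G x₀ :=
  if h : segment ℝ y x ⊆ G then
    basedLoop x₀ (.mk (segmentPath ⟨y, h (left_mem_segment ℝ y x)⟩
      ⟨x, h (right_mem_segment ℝ y x)⟩ h))
  else 1

theorem segmentClass_eq {G K : Set ℂ} [PathConnectedSpace G] (x₀ : G) (hK : Convex ℝ K)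
    (hKG : K ⊆ G) {x y : G} (p : Path y x) (hp : ∀ t, (p t : ℂ) ∈ K) :
    segmentClass x₀ (x : ℂ) y = basedLoop x₀ (.mk p) := by
  have hx : (x : ℂ) ∈ K := by simpa using hp 1
  have hy : (y : ℂ) ∈ K := by simpa using hp 0
  have h : segment ℝ (y : ℂ) x ⊆ K := hK.segment_subset hy hx
  rw [segmentClass, dif_pos (h.trans hKG)]
  congr 1
  exact Path.Homotopic.Quotient.eq.2 (homotopic_of_convex hK hKG _ _
    (fun t => h (segmentPath_mem y x (h.trans hKG) t)) hp)

theorem isLocalCocycle_segmentClass {G : Set ℂ} [PathConnectedSpace G] (x₀ : G) :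
    IsLocalCocycle G (segmentClass x₀) := by
  intro K hKG hK x hx y hy z hz
  have hxy := (hK.segment_subset hy hx)
  have hyz := (hK.segment_subset hz hy)
  have e1 := segmentClass_eq x₀ hK hKG (segmentPath ⟨y, hKG hy⟩ ⟨x, hKG hx⟩ (hxy.trans hKG))
    (fun t => hxy (segmentPath_mem ⟨y, hKG hy⟩ ⟨x, hKG hx⟩ (hxy.trans hKG) t))
  have e2 := segmentClass_eq x₀ hK hKG (segmentPath ⟨z, hKG hz⟩ ⟨y, hKG hy⟩ (hyz.trans hKG))
    (fun t => hyz (segmentPath_mem ⟨z, hKG hz⟩ ⟨y, hKG hy⟩ (hyz.trans hKG) t))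
  have e3 := segmentClass_eq x₀ hK hKG
    ((segmentPath ⟨z, hKG hz⟩ ⟨y, hKG hy⟩ (hyz.trans hKG)).trans
      (segmentPath ⟨y, hKG hy⟩ ⟨x, hKG hx⟩ (hxy.trans hKG)))
    (fun t => by
      rw [Path.trans_apply]
      split_ifs
      · exact hyz (segmentPath_mem ⟨z, hKG hz⟩ ⟨y, hKG hy⟩ (hyz.trans hKG) _)
      · exact hxy (segmentPath_mem ⟨y, hKG hy⟩ ⟨x, hKG hx⟩ (hxy.trans hKG) _))
  rw [e1, e2, e3, basedLoop_mul, Path.Homotopic.Quotient.mk_trans]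

theorem IsLocalCocycle.comp_affine {π : Type*} [Group π] {G : Set ℂ} {e : ℂ → ℂ → π}
    (he : IsLocalCocycle G e) (o : ℂ) (δ : ℝ) :
    IsLocalCocycle ((fun x : ℂ => o + δ • x) ⁻¹' G) fun x y => e (o + δ • x) (o + δ • y) := by
  intro K hKG hK x hx y hy z hz
  have hc : Convex ℝ ((fun x : ℂ => o + δ • x) '' K) := by
    have := (hK.smul δ).vadd o
    rwa [← image_vadd, ← image_smul, image_image] at this
  exact he _ (image_subset_iff.2 hKG) hc _ (mem_image_of_mem _ hx) _ (mem_image_of_mem _ hy) _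
    (mem_image_of_mem _ hz)

theorem HasUnboundedComplement.comp_affine {G : Set ℂ} (hG : HasUnboundedComplement G) (o : ℂ)
    {δ : ℝ} (hδ : δ ≠ 0) : HasUnboundedComplement ((fun x : ℂ => o + δ • x) ⁻¹' G) := by
  intro p hp
  obtain ⟨T, hTG, hT, hTb, hpT⟩ := hG _ hp
  have hinv : ∀ x : ℂ, o + δ • (δ⁻¹ • (x - o)) = x := fun x => by
    rw [smul_inv_smul₀ hδ]; ring
  refine ⟨(fun x : ℂ => δ⁻¹ • (x - o)) '' T, ?_, hT.image _ (by fun_prop), ?_, ?_⟩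
  · rintro _ ⟨x, hx, rfl⟩ h
    simp only [mem_preimage, hinv] at h
    exact hTG hx h
  · intro hb
    apply hTb
    have h1 := (hb.smul₀ δ).vadd o
    refine h1.subset fun x hx => ?_
    rw [← image_vadd, ← image_smul, image_image, image_image]
    exact ⟨x, hx, hinv x⟩
  · exact ⟨_, hpT, by simp [hδ]⟩

/-- A bounded path connected open set none of whose complementary components is bounded is
simply connected. -/
theorem isSimplyConnected_of_hasUnboundedComplement {G : Set ℂ} (hGo : IsOpen G)
    (hGc : IsPathConnected G) (hGb : Bornology.IsBounded G) (hG : HasUnboundedComplement G) :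
    IsSimplyConnected G := by
  have : PathConnectedSpace G := isPathConnected_iff_pathConnectedSpace.1 hGc
  refine simply_connected_iff_loops_nullhomotopic.2 ⟨this, fun x₀ γ => ?_⟩
  -- a uniform radius along the loop
  have hcomp : IsCompact (range fun t => (γ t : ℂ)) := isCompact_range (by fun_prop)
  obtain ⟨ε, hε, hεG⟩ := hcomp.exists_thickening_subset_open hGo
    (by rintro _ ⟨t, rfl⟩; exact (γ t).2)
  set δ : ℝ := ε / 5 with hδ
  have hδ0 : 0 < δ := by positivity
  obtain ⟨M, hM⟩ := isBounded_iff_forall_norm_le.1 hGb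
  set o : ℂ := ⟨-M, -M⟩ with ho
  have huc : UniformContinuous fun t : I => (γ t : ℂ) :=
    CompactSpace.uniformContinuous_of_continuous (by fun_prop)
  obtain ⟨η, hη, hγη⟩ := Metric.uniformContinuous_iff.1 huc δ hδ0
  obtain ⟨N, hN⟩ := exists_nat_one_div_lt hη
  have hN0 : (0 : ℝ) < N + 1 := by positivity
  let τ : ℕ → I := fun n => Set.projIcc (0 : ℝ) 1 zero_le_one (n / (N + 1))
  have hτ : ∀ n, dist (τ n) (τ (n + 1)) < η := by
    intro n
    rw [Subtype.dist_eq, Real.dist_eq]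
    refine (abs_projIcc_sub_projIcc zero_le_one).trans_lt ?_
    rw [← sub_div, abs_div, abs_of_pos hN0]
    simpa using hN
  have hτ0 : τ 0 = 0 := by simp [τ]
  have hτN : τ (N + 1) = 1 := by
    simp only [τ]
    push_cast
    rw [div_self hN0.ne', projIcc_right]
    rfl
  set y : ℕ → ℂ := fun n => δ⁻¹ • ((γ (τ n) : ℂ) - o) with hy
  have hyo : ∀ n, o + δ • y n = γ (τ n) := fun n => by
    simp only [hy]; rw [smul_inv_smul₀ hδ0.ne']; ring
  have hballG : ∀ t : I, Metric.ball (γ t : ℂ) ε ⊆ G := fun t x hx =>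
    hεG (Metric.mem_thickening_iff.2 ⟨_, ⟨t, rfl⟩, hx⟩)
  have hchain := IsLocalCocycle.chain_eq_one (hG.comp_affine o hδ0.ne')
    ((isLocalCocycle_segmentClass x₀).comp_affine o δ) (y := y) (N := N + 1)
    (C := fun n => basedLoop x₀ (.mk (γ.subpath (τ n) 0)))
    (fun n _ => by
      have h1 := hM _ (γ (τ n)).2
      have h2 := (abs_le.1 ((Complex.abs_re_le_norm (γ (τ n) : ℂ)).trans h1)).1
      simp only [hy, ho, Complex.real_smul, Complex.mul_re, Complex.ofReal_re, Complex.ofReal_im,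
        Complex.sub_re, zero_mul, sub_zero]
      have : 0 ≤ (γ (τ n) : ℂ).re - -M := by linarith
      positivity)
    (fun n _ => by
      have h1 := hM _ (γ (τ n)).2
      have h2 := (abs_le.1 ((Complex.abs_im_le_norm (γ (τ n) : ℂ)).trans h1)).1
      simp only [hy, ho, Complex.real_smul, Complex.mul_im, Complex.ofReal_re, Complex.ofReal_im,
        Complex.sub_im, zero_mul, add_zero]
      have : 0 ≤ (γ (τ n) : ℂ).im - -M := by linarith
      positivity)
    (fun n _ x hx => by
      apply hballG (τ n)
      rw [Metric.mem_ball, dist_eq_norm] at hx ⊢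
      rw [← hyo, add_sub_add_left_eq_sub, ← smul_sub, norm_smul, Real.norm_of_nonneg hδ0.le]
      rw [hδ] at hδ0 ⊢
      nlinarith)
    (fun n _ => by
      have h1 := (hγη (hτ n)).le
      rw [dist_eq_norm, ← hyo, ← hyo, add_sub_add_left_eq_sub, ← smul_sub, norm_smul,
        Real.norm_of_nonneg hδ0.le, norm_sub_rev] at h1
      nlinarith)
    (by simp only [hy]; rw [hτ0, hτN]; simp)
    (by
      rw [hτ0, Path.subpath_self, Path.Homotopic.Quotient.mk_refl, basedLoop_refl])
    (fun n _ => by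
      have h1 := segmentClass_eq x₀ (convex_ball _ _) (hballG (τ n)) (γ.subpath (τ (n + 1)) (τ n))
        (fun t => by
          have h2 : γ.subpath (τ (n + 1)) (τ n) t ∈ range (γ.subpath (τ (n + 1)) (τ n)) := ⟨t, rfl⟩
          rw [Path.range_subpath] at h2
          obtain ⟨s, hs, hst⟩ := h2
          rw [← hst]
          have h3 : dist s (τ n) < η := by
            refine lt_of_le_of_lt ?_ (hτ n)
            rw [dist_comm (τ n)]
            rw [Subtype.dist_eq, Subtype.dist_eq, Real.dist_eq, Real.dist_eq]
            have := hs
            rw [Set.uIcc_comm] at this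
            exact abs_sub_left_of_mem_uIcc (by
              rw [Set.mem_uIcc] at this ⊢
              exact this)
          exact (hγη h3).trans (by rw [hδ]; linarith))
      simp only [hyo]
      rw [h1, basedLoop_mul, ← Path.Homotopic.Quotient.mk_trans]
      congr 1
      exact (Path.Homotopic.Quotient.eq.2
        ⟨Path.Homotopy.subpathTransSubpath γ (τ (n + 1)) (τ n) 0⟩).symm)
  rw [hτN, ← Path.symm_subpath, Path.subpath_zero_one] at hchain
  have hcast : ∀ (a b : G) (ha : a = x₀) (hb : b = x₀),
      basedLoop x₀ (.mk (γ.cast ha hb).symm) = 1 → γ.Homotopic (Path.refl x₀) := by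
    intro a b ha hb h
    subst ha hb
    rw [Path.cast_rfl_rfl, Path.Homotopic.Quotient.mk_symm] at h
    have h1 := eq_refl_of_basedLoop_eq_one _ _ h
    rw [← Path.Homotopic.Quotient.mk_symm, ← Path.Homotopic.Quotient.mk_refl] at h1
    simpa using (Path.Homotopic.Quotient.eq.1 h1).symm₂
  exact hcast _ _ _ _ hchain

theorem inter_frontier_nonempty {X : Type*} [TopologicalSpace X] {C G : Set X}
    (hC : IsPreconnected C) (h1 : (C ∩ G).Nonempty) (h2 : (C ∩ Gᶜ).Nonempty) :
    (C ∩ frontier G).Nonempty := by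
  by_contra h
  rw [not_nonempty_iff_eq_empty] at h
  have hfr : ∀ x ∈ C, x ∉ frontier G := fun x hx hx' => (h ▸ ⟨hx, hx'⟩ : x ∈ (∅ : Set X))
  obtain ⟨x, hx, hx1, hx2⟩ := hC (interior G) (closure G)ᶜ isOpen_interior
    isClosed_closure.isOpen_compl
    (fun x hx => by
      by_cases hxi : x ∈ interior G
      · exact Or.inl hxi
      · exact Or.inr fun hxc => hfr x hx ⟨hxc, hxi⟩)
    (by
      obtain ⟨x, hx, hxG⟩ := h1
      refine ⟨x, hx, ?_⟩
      by_contra hxi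
      exact hfr x hx ⟨subset_closure hxG, hxi⟩)
    (by
      obtain ⟨x, hx, hxG⟩ := h2
      refine ⟨x, hx, fun hxc => hfr x hx ⟨hxc, fun hxi => hxG (interior_subset hxi)⟩⟩)
  exact hx2 (subset_closure (interior_subset hx1))

theorem exists_cutoff {P Q : Set ℂ} (hP : IsClosed P) (hQ : IsClosed Q) (h : Disjoint P Q) :
    ∃ χ : ℂ → ℝ, Continuous χ ∧ (∀ z ∈ P, ∀ᶠ w in 𝓝 z, χ w = 0) ∧
      ∀ z ∈ Q, ∀ᶠ w in 𝓝 z, χ w = 1 := by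
  obtain ⟨φ, h0, h1, -⟩ := exists_continuous_zero_one_of_isClosed hP hQ h
  refine ⟨fun z => max 0 (min 1 (3 * φ z - 1)), by fun_prop, fun z hz => ?_, fun z hz => ?_⟩
  · have : ∀ᶠ w in 𝓝 z, φ w < 1 / 3 :=
      φ.continuous.continuousAt.eventually_lt continuousAt_const (by simp [h0 hz])
    filter_upwards [this] with w hw
    rw [max_eq_left]
    exact (min_le_right _ _).trans (by linarith)
  · have : ∀ᶠ w in 𝓝 z, 2 / 3 < φ w :=
      continuousAt_const.eventually_lt φ.continuous.continuousAt (by simp [h1 hz]; norm_num)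
    filter_upwards [this] with w hw
    rw [min_eq_left (by linarith)]
    simp

/-- A nowhere vanishing continuous function on the plane has a continuous logarithm. -/
theorem exists_continuous_log {h : ℂ → ℂ} (hc : Continuous h) (h0 : ∀ z, h z ≠ 0) :
    ∃ H : ℂ → ℂ, Continuous H ∧ ∀ z, Complex.exp (H z) = h z := by
  have hsc : IsSimplyConnected (univ : Set ℂ) := by
    have : ContractibleSpace (univ : Set ℂ) := convex_univ.contractibleSpace univ_nonempty
    exact SimplyConnectedSpace.ofContractible _
  obtain ⟨H, hH, hH'⟩ := Complex.exists_continuousOn_eqOn_exp_comp hsc isOpen_univ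
    hc.continuousOn (by rintro ⟨z, -, hz⟩; exact h0 z hz)
  exact ⟨H, continuousOn_univ.1 hH, fun z => hH' (mem_univ z)⟩

theorem eqOn_of_exp_eq {X : Type*} [TopologicalSpace X] {S : Set X} (hS : IsPreconnected S)
    {g₁ g₂ : X → ℂ} (h₁ : ContinuousOn g₁ S) (h₂ : ContinuousOn g₂ S)
    (h : ∀ x ∈ S, Complex.exp (g₁ x) = Complex.exp (g₂ x)) {a : X} (ha : a ∈ S)
    (hga : g₁ a = g₂ a) : EqOn g₁ g₂ S :=
  Complex.isCoveringMap_exp.eqOn_of_comp_eqOn hS h₁ h₂ (fun x hx => Subtype.ext (h x hx)) ha hga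

theorem isConnected_compl_closedBall {r : ℝ} (hr : 0 < r) :
    IsConnected (Metric.closedBall (0 : ℂ) r)ᶜ := by
  have hcv : Convex ℝ {z : ℂ | Real.log r < z.re} := convex_halfSpace_re_gt _
  have h : (Metric.closedBall (0 : ℂ) r)ᶜ = Complex.exp '' {z : ℂ | Real.log r < z.re} := by
    ext z
    simp only [mem_compl_iff, mem_closedBall_zero_iff, not_le, mem_image, mem_ofPred_eq]
    constructor
    · intro hz
      have hz0 : z ≠ 0 := by rintro rfl; simp at hz; linarith
      exact ⟨Complex.log z, by rw [Complex.log_re]; exact Real.log_lt_log hr hz, Complex.exp_log hz0⟩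
    · rintro ⟨w, hw, rfl⟩
      rw [Complex.norm_exp]
      exact (Real.log_lt_iff_lt_exp hr).1 hw
  rw [h]
  refine IsConnected.image (s := {z : ℂ | Real.log r < z.re})
    ⟨⟨(Real.log r + 1 : ℝ), ?_⟩, hcv.isPreconnected⟩ _ Complex.continuous_exp.continuousOn
  simp

/-- There is no continuous branch of `log (z - p)` near `∞`. -/
theorem not_exists_log_near_infinity (p : ℂ) (r : ℝ) (H : ℂ → ℂ) (hH : Continuous H)
    (h : ∀ z, r < ‖z‖ → Complex.exp (H z) = z - p) : False := by
  set s : ℝ := |r| + ‖p‖ + 1 with hs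
  have hs0 : 0 < s := by positivity
  set c : ℝ → ℂ := fun θ => p + s * Complex.exp (θ * Complex.I) with hc
  have hcr : ∀ θ, r < ‖c θ‖ := by
    intro θ
    have h1 : ‖(s : ℂ) * Complex.exp (θ * Complex.I)‖ = s := by
      rw [norm_mul, Complex.norm_exp_ofReal_mul_I, mul_one, Complex.norm_real,
        Real.norm_of_nonneg hs0.le]
    have h2 := norm_sub_norm_le ((s : ℂ) * Complex.exp (θ * Complex.I)) (-p)
    rw [h1, norm_neg, sub_neg_eq_add, add_comm _ p] at h2
    have h3 := le_abs_self r
    change r < ‖p + s * Complex.exp (θ * Complex.I)‖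
    linarith
  have hcont : Continuous c := by fun_prop
  have hE := eqOn_of_exp_eq (S := (univ : Set ℝ)) isPreconnected_univ
    (g₁ := fun θ => H (c θ)) (g₂ := fun θ => H (c 0) + θ * Complex.I)
    (by fun_prop) (by fun_prop)
    (fun θ _ => by
      rw [h _ (hcr θ), Complex.exp_add, h _ (hcr 0)]
      simp [hc]) (mem_univ (0 : ℝ)) (by simp)
  have h1 := hE (mem_univ (2 * Real.pi))
  have h2 : c (2 * Real.pi) = c 0 := by
    simp only [hc]
    push_cast
    rw [Complex.exp_two_pi_mul_I]
    simp
  simp only [h2] at h1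
  have h3 : ((2 * Real.pi : ℝ) : ℂ) * Complex.I = 0 := by linear_combination -h1
  rw [mul_eq_zero] at h3
  rcases h3 with h3 | h3
  · have := Real.pi_pos
    norm_cast at h3
    linarith
  · exact Complex.I_ne_zero h3

/-- The complement of a bounded simply connected plane domain is connected. -/
theorem isPreconnected_compl_of_isSimplyConnected {U : Set ℂ} (hUo : IsOpen U)
    (hUc : IsSimplyConnected U) (hUb : Bornology.IsBounded U) : IsPreconnected Uᶜ := by
  obtain ⟨r, hr, hUr⟩ : ∃ r : ℝ, 0 < r ∧ U ⊆ Metric.closedBall 0 r := by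
    obtain ⟨r, hr⟩ := hUb.subset_closedBall 0
    exact ⟨max r 1, by positivity, hr.trans (Metric.closedBall_subset_closedBall (le_max_left _ _))⟩
  -- no piece of the complement is separated from infinity
  have key : ∀ P Q : Set ℂ, IsClosed P → IsClosed Q → Disjoint P Q → P ∪ Q = Uᶜ → P.Nonempty →
      ¬ (Metric.closedBall (0 : ℂ) r)ᶜ ⊆ Q := by
    rintro P Q hP hQ hPQ hPU ⟨p, hp⟩ hfar
    have hpU : p ∉ U := fun h => (hPU ▸ Or.inl hp : p ∈ Uᶜ) h
    obtain ⟨χ, hχ, hχP, hχQ⟩ := exists_cutoff hP hQ hPQ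
    obtain ⟨L, hL, hLe⟩ := Complex.exists_continuousOn_eqOn_exp_comp hUc hUo
      (g := fun z => z - p) (by fun_prop)
      (by rintro ⟨z, hz, hzp⟩; exact hpU (sub_eq_zero.1 hzp ▸ hz))
    classical
    set h : ℂ → ℂ := fun z => if z ∈ U then Complex.exp (χ z * L z) else if z ∈ P then 1 else z - p
      with hh
    have hnear : ∀ z ∈ Q, ∀ᶠ w in 𝓝 z, h w = w - p := by
      intro z hz
      filter_upwards [hχQ z hz, hP.isOpen_compl.mem_nhds (Set.disjoint_right.1 hPQ hz)]
        with w hw hwP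
      by_cases hwU : w ∈ U
      · simp only [hh, if_pos hwU, hw, Complex.ofReal_one, one_mul]
        exact hLe hwU
      · have : w ∉ P := hwP
        simp only [hh, if_neg hwU, if_neg this]
    have hcont : Continuous h := by
      rw [continuous_iff_continuousAt]
      intro z
      by_cases hzU : z ∈ U
      · have : ContinuousAt (fun z => Complex.exp (χ z * L z)) z := by
          have := hL.continuousAt (hUo.mem_nhds hzU)
          fun_prop
        refine this.congr ?_
        filter_upwards [hUo.mem_nhds hzU] with w hw
        simp only [hh, if_pos hw]
      · have : z ∈ P ∪ Q := hPU ▸ hzU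
        rcases this with hz | hz
        · refine (continuousAt_const (y := (1 : ℂ))).congr ?_
          filter_upwards [hχP z hz, hQ.isOpen_compl.mem_nhds (Set.disjoint_left.1 hPQ hz)]
            with w hw hwQ
          by_cases hwU : w ∈ U
          · simp [hh, if_pos hwU, hw]
          · have : w ∈ P := ((hPU.symm ▸ hwU : w ∈ P ∪ Q)).resolve_right hwQ
            simp only [hh, if_neg hwU, if_pos this]
        · refine ContinuousAt.congr (f := fun w => w - p) (by fun_prop) ?_
          filter_upwards [hnear z hz] with w hw using hw.symm
    have hne : ∀ z, h z ≠ 0 := by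
      intro z
      simp only [hh]
      split_ifs with h1 h2
      · exact Complex.exp_ne_zero _
      · exact one_ne_zero
      · exact sub_ne_zero.2 fun h3 => h2 (h3 ▸ hp)
    obtain ⟨H, hH, hHe⟩ := exists_continuous_log hcont hne
    refine not_exists_log_near_infinity p r H hH fun z hz => ?_
    rw [hHe]
    exact (hnear z (hfar (by simpa using hz))).self_of_nhds
  rw [isPreconnected_closed_iff]
  intro t t' ht ht' hsub h1 h2
  by_contra hemp
  rw [not_nonempty_iff_eq_empty] at hemp
  have hdis : Disjoint (Uᶜ ∩ t) (Uᶜ ∩ t') := by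
    rw [Set.disjoint_iff_inter_eq_empty, ← hemp]
    ext x
    simp only [mem_inter_iff]
    tauto
  have hun : (Uᶜ ∩ t) ∪ (Uᶜ ∩ t') = Uᶜ := by
    rw [← inter_union_distrib_left, inter_eq_left.2 hsub]
  have hc1 := hUo.isClosed_compl.inter ht
  have hc2 := hUo.isClosed_compl.inter ht'
  have hfar : (Metric.closedBall (0 : ℂ) r)ᶜ ⊆ Uᶜ := compl_subset_compl.2 hUr
  have hconn := (isConnected_compl_closedBall hr).isPreconnected
  rcases isPreconnected_iff_subset_of_disjoint_closed.1 hconn _ _ hc1 hc2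
    (by rw [hun]; exact hfar)
    (by rw [hdis.inter_eq, inter_empty]) with h | h
  · exact key _ _ hc2 hc1 hdis.symm (by rw [union_comm, hun]) h2 h
  · exact key _ _ hc1 hc2 hdis hun h1 h

/-- The boundary of a plane domain with connected complement is connected. -/
theorem isPreconnected_frontier {U : Set ℂ} (hUo : IsOpen U) (hU : IsPreconnected U)
    (hUc : IsPreconnected Uᶜ) : IsPreconnected (frontier U) := by
  rw [isPreconnected_closed_iff]
  intro t t' ht ht' hsub h1 h2
  by_contra hemp
  rw [not_nonempty_iff_eq_empty] at hemp
  have hdis : Disjoint (frontier U ∩ t) (frontier U ∩ t') := by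
    rw [Set.disjoint_iff_inter_eq_empty, ← hemp]
    ext x
    simp only [mem_inter_iff]
    tauto
  have hfr : ∀ z ∈ frontier U, z ∉ U := fun z hz hzU => by
    rw [hUo.frontier_eq] at hz; exact hz.2 hzU
  obtain ⟨q, hq⟩ := h1
  obtain ⟨p, hp⟩ := h2
  obtain ⟨χ, hχ, hχ0, hχ1⟩ := exists_cutoff (isClosed_frontier.inter ht)
    (isClosed_frontier.inter ht') hdis
  classical
  set h : ℂ → ℂ := fun z => if z ∈ U then Complex.exp (2 * Real.pi * Complex.I * χ z) else 1 with hh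
  have hcont : Continuous h := by
    rw [continuous_iff_continuousAt]
    intro z
    by_cases hzU : z ∈ U
    · refine ContinuousAt.congr (f := fun z => Complex.exp (2 * Real.pi * Complex.I * χ z))
        (by fun_prop) ?_
      filter_upwards [hUo.mem_nhds hzU] with w hw
      simp only [hh, if_pos hw]
    · refine (continuousAt_const (y := (1 : ℂ))).congr ?_
      by_cases hzc : z ∈ closure U
      · have hzf : z ∈ frontier U := by rw [hUo.frontier_eq]; exact ⟨hzc, hzU⟩
        rcases hsub hzf with hz | hz
        · filter_upwards [hχ0 z ⟨hzf, hz⟩] with w hw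
          simp [hh, hw]
        · filter_upwards [hχ1 z ⟨hzf, hz⟩] with w hw
          simp [hh, hw, Complex.exp_two_pi_mul_I]
      · filter_upwards [isClosed_closure.isOpen_compl.mem_nhds hzc] with w hw
        have : w ∉ U := fun h => hw (subset_closure h)
        simp only [hh, if_neg this]
  have hne : ∀ z, h z ≠ 0 := by
    intro z
    simp only [hh]
    split_ifs
    · exact Complex.exp_ne_zero _
    · exact one_ne_zero
  obtain ⟨H, hH, hHe⟩ := exists_continuous_log hcont hne
  -- `H` is constant off `U`, and `H - 2πiχ` is constant on `U`
  have e1 : EqOn H (fun _ => H q) Uᶜ :=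
    eqOn_of_exp_eq hUc hH.continuousOn continuousOn_const
      (fun x hx => by
        have hx' : x ∉ U := hx
        rw [hHe, hHe]; simp only [hh, if_neg hx', if_neg (hfr q hq.1)])
      (hfr q hq.1) rfl
  have hpq : H p = H q := e1 (hfr p hp.1)
  have hUne : U.Nonempty := by
    rw [← closure_nonempty_iff]
    exact ⟨q, hq.1.1⟩
  obtain ⟨u, hu⟩ := hUne
  have e2 : EqOn (fun z => H z - 2 * Real.pi * Complex.I * χ z)
      (fun _ => H u - 2 * Real.pi * Complex.I * χ u) U :=
    eqOn_of_exp_eq hU (by fun_prop) continuousOn_const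
      (fun x hx => by
        rw [Complex.exp_sub, Complex.exp_sub, hHe, hHe]
        simp only [hh, if_pos hx, if_pos hu, div_self (Complex.exp_ne_zero _)])
      hu rfl
  have e3 := e2.closure (by fun_prop) continuous_const
  have hq' := e3 hq.1.1
  have hp' := e3 hp.1.1
  simp only [(hχ0 q hq).self_of_nhds, (hχ1 p hp).self_of_nhds, hpq] at hq' hp'
  rw [← hq'] at hp'
  have h4 : (2 * Real.pi * Complex.I : ℂ) = 0 := by
    push_cast at hp'
    linear_combination -hp'
  exact Complex.two_pi_I_ne_zero h4

/-- Filling in the holes of a bounded plane domain yields a simply connected domain. -/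
theorem exists_isSimplyConnected_superset {G : Set ℂ} (hGo : IsOpen G) (hGc : IsConnected G)
    (hGb : Bornology.IsBounded G) :
    ∃ V : Set ℂ, IsOpen V ∧ IsSimplyConnected V ∧ Bornology.IsBounded V ∧ G ⊆ V ∧
      frontier V ⊆ frontier G := by
  obtain ⟨r, hr, hGr⟩ : ∃ r : ℝ, 0 < r ∧ G ⊆ Metric.closedBall 0 r := by
    obtain ⟨r, hr⟩ := hGb.subset_closedBall 0
    exact ⟨max r 1, by positivity, hr.trans (Metric.closedBall_subset_closedBall (le_max_left _ _))⟩
  have hfar := isConnected_compl_closedBall hr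
  obtain ⟨w, hw⟩ := hfar.nonempty
  have hfarG : (Metric.closedBall (0 : ℂ) r)ᶜ ⊆ Gᶜ := compl_subset_compl.2 hGr
  set T := connectedComponentIn Gᶜ w with hT
  have hTG : T ⊆ Gᶜ := connectedComponentIn_subset _ _
  have hTc : IsPreconnected T := isPreconnected_connectedComponentIn
  have hwT : w ∈ T := mem_connectedComponentIn (hfarG hw)
  have hmaxT : ∀ S : Set ℂ, IsPreconnected S → S ⊆ Gᶜ → (S ∩ T).Nonempty → S ⊆ T := by
    rintro S hS hSG ⟨x, hxS, hxT⟩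
    have h1 := IsPreconnected.union x hxS hxT hS hTc
    exact subset_union_left.trans
      (h1.subset_connectedComponentIn (Or.inr hwT) (union_subset hSG hTG))
  have hTclosed : IsClosed T := by
    rw [← closure_subset_iff_isClosed]
    exact hmaxT _ hTc.closure (closure_minimal hTG hGo.isClosed_compl) ⟨w, subset_closure hwT, hwT⟩
  have hfarT : (Metric.closedBall (0 : ℂ) r)ᶜ ⊆ T :=
    hmaxT _ hfar.isPreconnected hfarG ⟨w, hw, hwT⟩
  have hVo : IsOpen Tᶜ := hTclosed.isOpen_compl
  have hGV : G ⊆ Tᶜ := fun x hx hxT => hTG hxT hx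
  have hVr : Tᶜ ⊆ Metric.closedBall 0 r := by rw [compl_subset_comm]; exact hfarT
  have hVb : Bornology.IsBounded Tᶜ := Metric.isBounded_closedBall.subset hVr
  have hfr : frontier Tᶜ ⊆ frontier G := by
    rw [frontier_compl]
    intro x hx
    have hxT : x ∈ T := hTclosed.frontier_subset hx
    rw [hGo.frontier_eq]
    refine ⟨?_, hTG hxT⟩
    by_contra hxc
    obtain ⟨ε, hε, hb⟩ := Metric.isOpen_iff.1 isClosed_closure.isOpen_compl x hxc
    have h1 : Metric.ball x ε ⊆ T := hmaxT _ (convex_ball x ε).isPreconnected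
      (hb.trans (compl_subset_compl.2 subset_closure)) ⟨x, Metric.mem_ball_self hε, hxT⟩
    exact hx.2 (mem_interior.2 ⟨_, h1, Metric.isOpen_ball, Metric.mem_ball_self hε⟩)
  obtain ⟨g, hg⟩ := hGc.nonempty
  have hVc : IsConnected Tᶜ := by
    refine ⟨⟨g, hGV hg⟩, isPreconnected_of_forall g fun y hy => ?_⟩
    set B := connectedComponentIn Tᶜ y with hB
    have hBo : IsOpen B := hVo.connectedComponentIn
    have hyB : y ∈ B := mem_connectedComponentIn hy
    have hBV : B ⊆ Tᶜ := connectedComponentIn_subset _ _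
    have hBc : IsPreconnected B := isPreconnected_connectedComponentIn
    by_cases hBG : (B ∩ G).Nonempty
    · obtain ⟨x, hxB, hxG⟩ := hBG
      exact ⟨B ∪ G, union_subset hBV hGV, Or.inr hg, Or.inl hyB,
        IsPreconnected.union x hxB hxG hBc hGc.isPreconnected⟩
    exfalso
    have hBG' : B ⊆ Gᶜ := fun x hx hxG => hBG ⟨x, hx, hxG⟩
    have hfB : (frontier B).Nonempty := by
      by_contra h
      rw [not_nonempty_iff_eq_empty, frontier_eq_empty_iff] at h
      rcases h with h | h
      · exact (h ▸ hyB : y ∈ (∅ : Set ℂ))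
      · exact hBV (h ▸ mem_univ w) hwT
    obtain ⟨z, hz⟩ := hfB
    have hzT : z ∈ T := by
      by_contra hzT
      have h1 : IsOpen (connectedComponentIn Tᶜ z) := hVo.connectedComponentIn
      obtain ⟨x, hx1, hx2⟩ := mem_closure_iff.1 hz.1 _ h1 (mem_connectedComponentIn hzT)
      have h2 : connectedComponentIn Tᶜ z = B := by
        rw [hB, connectedComponentIn_eq hx1, connectedComponentIn_eq hx2]
      have h3 : z ∈ B := h2 ▸ mem_connectedComponentIn hzT
      rw [hBo.frontier_eq] at hz
      exact hz.2 h3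
    have h4 := hmaxT _ hBc.closure (closure_minimal hBG' hGo.isClosed_compl) ⟨z, hz.1, hzT⟩
    exact hy (h4 (subset_closure hyB))
  refine ⟨Tᶜ, hVo, ?_, hVb, hGV, hfr⟩
  refine isSimplyConnected_of_hasUnboundedComplement hVo (hVo.isConnected_iff_isPathConnected.1 hVc)
    hVb fun p hp => ⟨T, by rw [compl_compl], hTc, fun hb => ?_, not_not.1 hp⟩
  have := (hb.union Metric.isBounded_closedBall).subset
    (fun x _ => or_iff_not_imp_right.2 fun hx => hfarT hx : univ ⊆ T ∪ Metric.closedBall 0 r)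
  exact NormedSpace.unbounded_univ ℝ ℂ this

/-- **Bloch's theorem**, with a weak constant. -/
theorem exists_ball_subset_image {h : ℂ → ℂ} {c : ℂ} {r : ℝ} (hr : 0 < r)
    (hd : DifferentiableOn ℂ h (Metric.ball c r)) (h0 : deriv h c ≠ 0) :
    ∃ p, Metric.ball (h p) (‖deriv h c‖ * r / 96) ⊆ h '' Metric.ball c r := by
  have hd' : DifferentiableOn ℂ (deriv h) (Metric.ball c r) := hd.deriv Metric.isOpen_ball
  have hsub : Metric.closedBall c (r / 2) ⊆ Metric.ball c r :=
    Metric.closedBall_subset_ball (by linarith)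
  obtain ⟨p, hp, hmax⟩ := (isCompact_closedBall c (r / 2)).exists_isMaxOn
    ⟨c, Metric.mem_closedBall_self (by positivity)⟩
    (f := fun z => ‖deriv h z‖ * (r / 2 - dist z c))
    ((hd'.continuousOn.mono hsub).norm.mul (by fun_prop))
  have hφc := hmax (Metric.mem_closedBall_self (x := c) (by positivity : 0 ≤ r / 2))
  simp only [dist_self, sub_zero, mem_ofPred_eq] at hφc
  have hpos : 0 < ‖deriv h p‖ * (r / 2 - dist p c) :=
    lt_of_lt_of_le (by have := norm_pos_iff.2 h0; positivity) hφc
  have hdp : 0 < ‖deriv h p‖ := by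
    rcases (norm_nonneg (deriv h p)).eq_or_lt with h | h
    · rw [← h] at hpos; simp at hpos
    · exact h
  have hgap : 0 < r / 2 - dist p c := by
    by_contra h
    nlinarith
  set ρ : ℝ := (r / 2 - dist p c) / 2 with hρ
  have hρ0 : 0 < ρ := by positivity
  have hballsub : Metric.ball p ρ ⊆ Metric.closedBall c (r / 2) := by
    intro z hz
    rw [Metric.mem_ball] at hz
    rw [Metric.mem_closedBall]
    linarith [dist_triangle z p c]
  have hbound : ∀ z ∈ Metric.ball p ρ, ‖deriv h z‖ ≤ 2 * ‖deriv h p‖ := by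
    intro z hz
    have h1 := hmax (hballsub hz)
    simp only [mem_ofPred_eq] at h1
    have h2 : ρ ≤ r / 2 - dist z c := by
      rw [Metric.mem_ball] at hz
      linarith [dist_triangle z p c]
    have h3 : ‖deriv h z‖ * ρ ≤ ‖deriv h p‖ * (2 * ρ) := by
      calc ‖deriv h z‖ * ρ ≤ ‖deriv h z‖ * (r / 2 - dist z c) := by gcongr
        _ ≤ _ := h1
        _ = _ := by rw [hρ]; ring
    nlinarith
  -- the derivative is nearly constant near `p`
  have hschwarz : ∀ z ∈ Metric.ball p ρ,
      ‖deriv h z - deriv h p‖ ≤ 3 * ‖deriv h p‖ / ρ * ‖z - p‖ := by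
    intro z hz
    have := Complex.dist_le_div_mul_dist_of_mapsTo_ball
      (hd'.mono (hballsub.trans hsub)) (R₂ := 3 * ‖deriv h p‖)
      (fun w hw => by
        rw [mem_closedBall_iff_norm]
        have := norm_sub_le (deriv h w) (deriv h p)
        linarith [hbound w hw]) hz
    rwa [dist_eq_norm, dist_eq_norm] at this
  set s : ℝ := ρ / 6 with hs
  have hs0 : 0 < s := by positivity
  have hsρ : Metric.closedBall p s ⊆ Metric.ball p ρ :=
    Metric.closedBall_subset_ball (by rw [hs]; linarith)
  have hdiffAt : ∀ z ∈ Metric.ball p ρ, DifferentiableAt ℂ h z := fun z hz =>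
    hd.differentiableAt (Metric.isOpen_ball.mem_nhds (hsub (hballsub hz)))
  have hlin : ∀ z ∈ Metric.closedBall p s,
      ‖(h z - deriv h p * z) - (h p - deriv h p * p)‖ ≤ ‖deriv h p‖ / 2 * ‖z - p‖ := by
    intro z hz
    refine Convex.norm_image_sub_le_of_norm_hasDerivWithin_le (s := Metric.closedBall p s)
      (f := fun z => h z - deriv h p * z) (f' := fun z => deriv h z - deriv h p) ?_ ?_
      (convex_closedBall p s) (Metric.mem_closedBall_self hs0.le) hz
    · intro w hw
      have h1 := (hdiffAt w (hsρ hw)).hasDerivAt.fun_sub ((hasDerivAt_id w).const_mul (deriv h p))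
      simpa using h1.hasDerivWithinAt
    · intro w hw
      refine (hschwarz w (hsρ hw)).trans ?_
      rw [mem_closedBall_iff_norm] at hw
      calc 3 * ‖deriv h p‖ / ρ * ‖w - p‖ ≤ 3 * ‖deriv h p‖ / ρ * s := by gcongr
        _ = ‖deriv h p‖ / 2 := by rw [hs]; field_simp; norm_num
  have hlow : ∀ z ∈ Metric.closedBall p s, ‖deriv h p‖ / 2 * ‖z - p‖ ≤ ‖h z - h p‖ := by
    intro z hz
    have h1 := hlin z hz
    have h2 := norm_sub_norm_le (deriv h p * (z - p)) (-((h z - deriv h p * z) - (h p - deriv h p * p)))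
    rw [norm_neg, norm_mul] at h2
    have h3 : deriv h p * (z - p) - -((h z - deriv h p * z) - (h p - deriv h p * p)) = h z - h p := by
      ring
    rw [h3] at h2
    linarith
  refine ⟨p, ?_⟩
  have hdc : DiffContOnCl ℂ h (Metric.ball p s) := by
    apply DifferentiableOn.diffContOnCl
    rw [closure_ball p hs0.ne']
    exact fun z hz => (hdiffAt z (hsρ hz)).differentiableWithinAt
  have hmain := hdc.ball_subset_image_closedBall hs0 (ε := ‖deriv h p‖ / 2 * s)
    (fun z hz => by
      have := hlow z (Metric.sphere_subset_closedBall hz)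
      rwa [mem_sphere_iff_norm.1 hz] at this)
    (by
      have h1 : ∀ᶠ z in 𝓝[≠] p, h z ≠ h p := by
        filter_upwards [self_mem_nhdsWithin,
          mem_nhdsWithin_of_mem_nhds (Metric.closedBall_mem_nhds p hs0)] with z hz hz' heq
        have h2 := hlow z hz'
        rw [heq, sub_self, norm_zero] at h2
        have h3 : 0 < ‖z - p‖ := norm_pos_iff.2 (sub_ne_zero.2 hz)
        nlinarith [mul_pos hdp h3]
      exact h1.frequently.filter_mono nhdsWithin_le_nhds)
  refine (Metric.ball_subset_ball ?_).trans
    (hmain.trans (image_mono ((hsρ.trans hballsub).trans hsub)))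
  have : ‖deriv h p‖ / 2 * s / 2 = ‖deriv h p‖ * (r / 2 - dist p c) / 48 := by
    rw [hs, hρ]; ring
  rw [this]
  linarith

/-- A continuous logarithm of a holomorphic function is holomorphic. -/
theorem differentiableOn_of_exp {U : Set ℂ} (hU : IsOpen U) {g h : ℂ → ℂ}
    (hg : DifferentiableOn ℂ g U) (hh : ContinuousOn h U)
    (he : ∀ z ∈ U, Complex.exp (h z) = g z) : DifferentiableOn ℂ h U := by
  intro z hz
  have hgz : g z ≠ 0 := by rw [← he z hz]; exact Complex.exp_ne_zero _
  have hga := hg.differentiableAt (hU.mem_nhds hz)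
  have hha := hh.continuousAt (hU.mem_nhds hz)
  have h1 : DifferentiableAt ℂ (fun w => h z + Complex.log (g w / g z)) z := by
    refine (DifferentiableAt.clog (hga.div_const _) ?_).const_add _
    simp [hgz]
  refine (h1.congr_of_eventuallyEq ?_).differentiableWithinAt
  have h2 : ∀ᶠ w in 𝓝 z, |(h w - h z).im| < Real.pi := by
    have : ContinuousAt (fun w => |(h w - h z).im|) z := by fun_prop
    exact this.eventually_lt continuousAt_const (by simpa using Real.pi_pos)
  filter_upwards [h2, hU.mem_nhds hz] with w hw hwU
  rw [← he w hwU, ← he z hz, ← Complex.exp_sub,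
    Complex.log_exp (by linarith [(abs_lt.1 hw).1]) (abs_lt.1 hw).2.le]
  ring

theorem isSimplyConnected_ball (c : ℂ) {r : ℝ} (hr : 0 < r) :
    IsSimplyConnected (Metric.ball c r) := by
  have : ContractibleSpace (Metric.ball c r) := Metric.contractibleSpace_ball hr
  exact SimplyConnectedSpace.ofContractible _

/-- **Harnack's inequality** for `log ‖g‖`. -/
theorem log_norm_le_three_mul {g : ℂ → ℂ} {c : ℂ} {r : ℝ} (hr : 0 < r)
    (hd : DifferentiableOn ℂ g (Metric.ball c r)) (h1 : ∀ z ∈ Metric.ball c r, 1 < ‖g z‖)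
    {z : ℂ} (hz : z ∈ Metric.closedBall c (r / 2)) :
    Real.log ‖g z‖ ≤ 3 * Real.log ‖g c‖ := by
  obtain ⟨h, hh, he⟩ := Complex.exists_continuousOn_eqOn_exp_comp (isSimplyConnected_ball c hr)
    Metric.isOpen_ball hd.continuousOn
    (by rintro ⟨z, hz, h0⟩; have := h1 z hz; rw [h0, norm_zero] at this; linarith)
  have he' : ∀ z ∈ Metric.ball c r, Complex.exp (h z) = g z := he
  have hdh := differentiableOn_of_exp Metric.isOpen_ball hd hh he'
  have hre : ∀ z ∈ Metric.ball c r, Real.log ‖g z‖ = (h z).re := by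
    intro z hz
    rw [← he' z hz, Complex.norm_exp, Real.log_exp]
  have hc : c ∈ Metric.ball c r := Metric.mem_ball_self hr
  have hzb : z ∈ Metric.ball c r := Metric.closedBall_subset_ball (by linarith) hz
  have hpos : ∀ z ∈ Metric.ball c r, 0 < (h z).re := fun z hz => by
    rw [← hre z hz]; exact Real.log_pos (h1 z hz)
  have hmaps : ∀ w ∈ Metric.ball (0 : ℂ) r, c + w ∈ Metric.ball c r := fun w hw => by
    rw [mem_ball_iff_norm] at *; simpa using hw
  rw [mem_closedBall_iff_norm] at hz
  have hBC := Complex.borelCaratheodory_zero (f := fun w => h c - h (c + w)) (M := (h c).re) (R := r)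
    (z := z - c) (hpos c hc)
    ((differentiableOn_const _).sub (hdh.comp (by fun_prop) hmaps))
    (fun w hw => by
      simp only [mem_ofPred_eq, Complex.sub_re]
      linarith [hpos _ (hmaps w hw)]) hr
    (by rw [mem_ball_zero_iff]; linarith) (by simp)
  simp only [add_sub_cancel] at hBC
  have h2 : 2 * (h c).re * ‖z - c‖ / (r - ‖z - c‖) ≤ 2 * (h c).re := by
    rw [div_le_iff₀ (by linarith)]
    have := hpos c hc
    nlinarith
  have h3 := (Complex.abs_re_le_norm (h c - h z)).trans (hBC.trans h2)
  rw [hre z hzb, hre c hc]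
  have := (abs_le.1 h3).1
  simp only [Complex.sub_re] at this
  linarith

/-- **Montel's theorem** for bounded sequences on a disc. -/
theorem exists_subseq_tendstoLocallyUniformlyOn {g : ℕ → ℂ → ℂ} {c : ℂ} {r C : ℝ} (hr : 0 < r)
    (hd : ∀ n, DifferentiableOn ℂ (g n) (Metric.ball c r))
    (hC : ∀ n, ∀ z ∈ Metric.ball c r, ‖g n z‖ ≤ C) :
    ∃ ψ : ℕ → ℕ, StrictMono ψ ∧ ∃ G : ℂ → ℂ,
      TendstoLocallyUniformlyOn (fun n => g (ψ n)) G atTop (Metric.ball c (r / 2)) := by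
  set K := Metric.closedBall c (r / 2) with hK
  have hKsub : K ⊆ Metric.ball c r := Metric.closedBall_subset_ball (by linarith)
  have hC0 : 0 ≤ C := (norm_nonneg _).trans (hC 0 c (Metric.mem_ball_self hr))
  have hlip : ∀ n, ∀ x ∈ K, ∀ y ∈ K, ‖g n y - g n x‖ ≤ C / (r / 4) * ‖y - x‖ := by
    intro n x hx y hy
    refine Convex.norm_image_sub_le_of_norm_hasDerivWithin_le (s := K) (f' := deriv (g n)) ?_ ?_
      (convex_closedBall c _) hx hy
    · intro w hw
      exact ((hd n).differentiableAt
        (Metric.isOpen_ball.mem_nhds (hKsub hw))).hasDerivAt.hasDerivWithinAt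
    · intro w hw
      have hsub : Metric.closedBall w (r / 4) ⊆ Metric.ball c r := by
        intro u hu
        rw [Metric.mem_closedBall] at hu hw
        rw [Metric.mem_ball]
        linarith [dist_triangle u w c]
      refine Complex.norm_deriv_le_of_forall_mem_sphere_norm_le (by positivity) ?_
        fun u hu => hC n u (hsub (Metric.sphere_subset_closedBall hu))
      apply DifferentiableOn.diffContOnCl
      rw [closure_ball w (by positivity)]
      exact (hd n).mono hsub
  have : CompactSpace K := isCompact_iff_compactSpace.1 (isCompact_closedBall _ _)
  let F : ℕ → BoundedContinuousFunction K ℂ := fun n => BoundedContinuousFunction.mkOfCompact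
    ⟨fun x => g n x, ((hd n).continuousOn.mono hKsub).domRestrict⟩
  have hcomp : IsCompact (closure (range F)) := by
    refine BoundedContinuousFunction.arzela_ascoli (Metric.closedBall (0 : ℂ) C)
      (isCompact_closedBall _ _) _ ?_ ?_
    · rintro f x ⟨n, rfl⟩
      rw [mem_closedBall_zero_iff]
      exact hC n x (hKsub x.2)
    · refine UniformEquicontinuous.equicontinuous
        (LipschitzWith.uniformEquicontinuous _ ⟨C / (r / 4), by positivity⟩ ?_)
      rintro ⟨f, n, rfl⟩
      refine LipschitzWith.of_dist_le_mul fun x y => ?_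
      rw [dist_eq_norm, Subtype.dist_eq, dist_eq_norm]
      exact hlip n y y.2 x x.2
  obtain ⟨a, -, ψ, hψ, hlim⟩ := hcomp.tendsto_subseq (x := F)
    fun n => subset_closure (mem_range_self n)
  rw [BoundedContinuousFunction.tendsto_iff_tendstoUniformly] at hlim
  classical
  refine ⟨ψ, hψ, fun z => if hz : z ∈ K then a ⟨z, hz⟩ else 0, ?_⟩
  refine TendstoUniformlyOn.tendstoLocallyUniformlyOn ?_
  rw [Metric.tendstoUniformlyOn_iff]
  intro ε hε
  filter_upwards [Metric.tendstoUniformly_iff.1 hlim ε hε] with n hn z hz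
  have hzK : z ∈ K := Metric.ball_subset_closedBall hz
  rw [dif_pos hzK]
  exact hn ⟨z, hzK⟩

variable {f : ℂ → ℂ}

theorem IsTranscendentalEntire.not_const (hf : IsTranscendentalEntire f) (c : ℂ) :
    ∃ z, f z ≠ c := by
  by_contra h
  push Not at h
  exact hf.2 ⟨Polynomial.C c, fun z => by simp [h z]⟩

theorem norm_le_maxModulus_norm (hf : Continuous f) (z : ℂ) : ‖f z‖ ≤ maxModulus f ‖z‖ := by
  refine le_csSup ?_ ⟨z, by simp, rfl⟩
  exact ((isCompact_sphere (0 : ℂ) ‖z‖).image hf.norm).bddAbove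

theorem exists_norm_eq_maxModulus (hf : Continuous f) {r : ℝ} (hr : 0 ≤ r) :
    ∃ z : ℂ, ‖z‖ = r ∧ ‖f z‖ = maxModulus f r := by
  have hne : ((fun z : ℂ => ‖f z‖) '' Metric.sphere (0 : ℂ) r).Nonempty :=
    (NormedSpace.sphere_nonempty.2 hr).image _
  obtain ⟨z, hz, hz'⟩ := ((isCompact_sphere (0 : ℂ) r).image hf.norm).sSup_mem hne
  exact ⟨z, by simpa using hz, hz'⟩

theorem norm_le_maxModulus (hf : Differentiable ℂ f) {r : ℝ} {z : ℂ} (hz : ‖z‖ ≤ r) :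
    ‖f z‖ ≤ maxModulus f r := by
  rcases hz.eq_or_lt with rfl | hlt
  · exact norm_le_maxModulus_norm hf.continuous z
  have hr : 0 < r := (norm_nonneg z).trans_lt hlt
  refine Complex.norm_le_of_forall_mem_frontier_norm_le (U := Metric.ball 0 r) Metric.isBounded_ball
    hf.diffContOnCl (fun w hw => ?_) (subset_closure (by simpa using hlt))
  rw [frontier_ball _ hr.ne', mem_sphere_zero_iff_norm] at hw
  rw [← hw]
  exact norm_le_maxModulus_norm hf.continuous w

theorem maxModulus_mono (hf : Differentiable ℂ f) {a b : ℝ} (ha : 0 ≤ a) (hab : a ≤ b) :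
    maxModulus f a ≤ maxModulus f b := by
  obtain ⟨z, hz, hz'⟩ := exists_norm_eq_maxModulus hf.continuous ha
  rw [← hz']
  exact norm_le_maxModulus hf (hz.le.trans hab)

theorem maxModulus_strictMono (hf : IsTranscendentalEntire f) {a b : ℝ} (ha : 0 ≤ a) (hab : a < b) :
    maxModulus f a < maxModulus f b := by
  refine lt_of_le_of_ne (maxModulus_mono hf.1 ha hab.le) fun heq => ?_
  obtain ⟨z, hz, hz'⟩ := exists_norm_eq_maxModulus hf.1.continuous ha
  have hb : 0 < b := ha.trans_lt hab
  have hzb : z ∈ Metric.ball (0 : ℂ) b := by simpa [hz] using hab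
  have hE := Complex.eqOn_of_isPreconnected_of_isMaxOn_norm (convex_ball (0 : ℂ) b).isPreconnected
    Metric.isOpen_ball hf.1.differentiableOn hzb (fun w hw => by
      simp only [mem_ofPred_eq, Function.comp_apply]
      rw [hz', heq]
      exact norm_le_maxModulus hf.1 (mem_ball_zero_iff.1 hw).le)
  obtain ⟨w, hw⟩ := hf.not_const (f z)
  have han : AnalyticOnNhd ℂ f univ := fun x _ => hf.1.analyticAt x
  have := han.eqOn_of_preconnected_of_eventuallyEq (analyticOnNhd_const (v := f z))
    isPreconnected_univ (mem_univ z)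
    (by filter_upwards [Metric.isOpen_ball.mem_nhds hzb] with x hx using hE hx)
  exact hw (this (mem_univ w))

/-- An entire function of at most polynomial growth along a sequence of radii is a polynomial. -/
theorem exists_polynomial_of_frequently_le (hf : Differentiable ℂ f) (K : ℕ)
    (h : ∃ᶠ r : ℝ in atTop, maxModulus f r ≤ r ^ K) :
    ∃ p : Polynomial ℂ, ∀ z : ℂ, f z = p.eval z := by
  have hzero : ∀ n, K < n → iteratedDeriv n f 0 = 0 := by
    intro n hn
    have hlim : Tendsto (fun r : ℝ => n.factorial * r ^ K / r ^ n) atTop (𝓝 0) := by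
      have h1 : Tendsto (fun r : ℝ => r ^ K / r ^ n) atTop (𝓝 0) :=
        tendsto_pow_div_pow_atTop_zero hn
      simpa [mul_div_assoc] using h1.const_mul (n.factorial : ℝ)
    have hle : ‖iteratedDeriv n f 0‖ ≤ 0 := by
      by_contra! hpos
      obtain ⟨r, hr, hlt⟩ := ((h.and_eventually (eventually_gt_atTop 0)).and_eventually
        (hlim.eventually (gt_mem_nhds hpos))).exists
      refine hlt.not_ge ?_
      refine Complex.norm_iteratedDeriv_le_of_forall_mem_sphere_norm_le n hr.2 hf.diffContOnCl
        fun z hz => ?_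
      rw [mem_sphere_zero_iff_norm] at hz
      exact (norm_le_maxModulus hf hz.le).trans hr.1
    exact norm_le_zero_iff.1 hle
  refine ⟨∑ n ∈ Finset.range (K + 1), Polynomial.C ((n.factorial : ℂ)⁻¹ * iteratedDeriv n f 0) *
    Polynomial.X ^ n, fun z => ?_⟩
  rw [← Complex.taylorSeries_eq_of_entire' 0 z hf, tsum_eq_sum (s := Finset.range (K + 1)),
    Polynomial.eval_finsetSum]
  · simp
  · intro n hn
    rw [Finset.mem_range] at hn
    rw [hzero n (by omega)]
    simp

theorem IsTranscendentalEntire.eventually_pow_lt (hf : IsTranscendentalEntire f) (K : ℕ) :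
    ∀ᶠ r : ℝ in atTop, r ^ K < maxModulus f r := by
  by_contra h
  rw [not_eventually] at h
  exact hf.2 (exists_polynomial_of_frequently_le hf.1 K (h.mono fun r hr => not_lt.1 hr))

/-- `M(r) / r ^ 2` is eventually nondecreasing. -/
theorem IsTranscendentalEntire.exists_div_sq_mono (hf : IsTranscendentalEntire f) :
    ∃ r₀ : ℝ, 1 ≤ r₀ ∧ ∀ a b, r₀ ≤ a → a ≤ b →
      maxModulus f a / a ^ 2 ≤ maxModulus f b / b ^ 2 := by
  obtain ⟨r₁, hr₁⟩ := eventually_atTop.1 (hf.eventually_pow_lt 3)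
  refine ⟨max (max r₁ 2) (maxModulus f 1), by
    have := le_max_right r₁ 2
    have := le_max_left (max r₁ 2) (maxModulus f 1)
    linarith, fun a b ha hab => ?_⟩
  have ha1 : r₁ ≤ a := (le_max_left _ _).trans ((le_max_left _ _).trans ha)
  have ha2 : 2 ≤ a := (le_max_right _ _).trans ((le_max_left _ _).trans ha)
  have ha3 : maxModulus f 1 ≤ a := (le_max_right _ _).trans ha
  have ha0 : 0 < a := by linarith
  have hlarge : maxModulus f 1 < maxModulus f a / a ^ 2 := by
    rw [lt_div_iff₀ (by positivity)]
    have := hr₁ a ha1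
    nlinarith [sq_nonneg a]
  obtain ⟨z, hz, hz'⟩ := exists_norm_eq_maxModulus hf.1.continuous ha0.le
  set A : Set ℂ := Metric.ball 0 b \ Metric.closedBall 0 1 with hA
  have hAo : IsOpen A := Metric.isOpen_ball.sdiff Metric.isClosed_closedBall
  have hclA : closure A ⊆ {w | 1 ≤ ‖w‖ ∧ ‖w‖ ≤ b} := by
    refine closure_minimal ?_ ?_
    · rintro w ⟨hw1, hw2⟩
      simp only [mem_ball_zero_iff, mem_closedBall_zero_iff, not_le] at hw1 hw2
      exact ⟨hw2.le, hw1.le⟩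
    · exact (isClosed_le continuous_const continuous_norm).inter
        (isClosed_le continuous_norm continuous_const)
  have hb0 : 0 < b := by linarith
  have hbound : ∀ w ∈ frontier A,
      ‖f w / w ^ 2‖ ≤ max (maxModulus f 1) (maxModulus f b / b ^ 2) := by
    intro w hw
    rw [hAo.frontier_eq] at hw
    obtain ⟨h1, h2⟩ := hclA hw.1
    have h3 : ‖w‖ = 1 ∨ ‖w‖ = b := by
      by_contra h
      push Not at h
      apply hw.2
      simp only [hA, Set.mem_sdiff, mem_ball_zero_iff, mem_closedBall_zero_iff, not_le]
      exact ⟨lt_of_le_of_ne h2 h.2, lt_of_le_of_ne h1 (Ne.symm h.1)⟩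
    rw [norm_div, norm_pow]
    rcases h3 with h3 | h3
    · refine le_max_of_le_left ?_
      rw [h3, one_pow, div_one]
      exact norm_le_maxModulus hf.1 h3.le
    · refine le_max_of_le_right ?_
      rw [h3]
      gcongr
      exact norm_le_maxModulus hf.1 h3.le
  have hmax : ‖f z / z ^ 2‖ ≤ max (maxModulus f 1) (maxModulus f b / b ^ 2) := by
    rcases hab.eq_or_lt with rfl | hlt
    · refine le_max_of_le_right ?_
      rw [norm_div, norm_pow, hz, hz']
    refine Complex.norm_le_of_forall_mem_frontier_norm_le (U := A) (f := fun w => f w / w ^ 2)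
      (Metric.isBounded_ball.subset sdiff_subset) ?_ hbound (subset_closure ?_)
    · refine DifferentiableOn.diffContOnCl (hf.1.differentiableOn.div (by fun_prop) fun w hw => ?_)
      have := (hclA hw).1
      have : w ≠ 0 := by rintro rfl; simp at this; linarith
      positivity
    · simp only [hA, Set.mem_sdiff, mem_ball_zero_iff, mem_closedBall_zero_iff, not_le, hz]
      exact ⟨hlt, by linarith⟩
  rw [norm_div, norm_pow, hz, hz'] at hmax
  rcases le_max_iff.1 hmax with h | h
  · linarith
  · exact h

section Iterates

variable {R : ℝ}

theorem le_iterate_maxModulus (hM : ∀ r : ℝ, R ≤ r → r < maxModulus f r) {s : ℝ} (hs : R ≤ s)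
    (n : ℕ) : s ≤ (maxModulus f)^[n] s := by
  induction n with
  | zero => simp
  | succ n ih =>
    rw [Function.iterate_succ_apply']
    exact ih.trans (hM _ (hs.trans ih)).le

theorem iterate_maxModulus_mono_nat (hM : ∀ r : ℝ, R ≤ r → r < maxModulus f r) {s : ℝ}
    (hs : R ≤ s) : Monotone fun n => (maxModulus f)^[n] s := by
  refine monotone_nat_of_le_succ fun n => ?_
  simp only [Function.iterate_succ_apply']
  exact (hM _ (hs.trans (le_iterate_maxModulus hM hs n))).le

theorem iterate_maxModulus_mono (hf : Differentiable ℂ f) {a b : ℝ} (ha : 0 ≤ a) (hab : a ≤ b)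
    (n : ℕ) : 0 ≤ (maxModulus f)^[n] a ∧ (maxModulus f)^[n] a ≤ (maxModulus f)^[n] b := by
  induction n with
  | zero => exact ⟨ha, hab⟩
  | succ n ih =>
    simp only [Function.iterate_succ_apply']
    refine ⟨?_, maxModulus_mono hf ih.1 ih.2⟩
    obtain ⟨z, -, hz⟩ := exists_norm_eq_maxModulus hf.continuous ih.1
    rw [← hz]
    exact norm_nonneg _

theorem norm_iterate_le (hf : Differentiable ℂ f) {s : ℝ} {z : ℂ} (hz : ‖z‖ ≤ s) (n : ℕ) :
    ‖f^[n] z‖ ≤ (maxModulus f)^[n] s := by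
  induction n with
  | zero => exact hz
  | succ n ih =>
    simp only [Function.iterate_succ_apply']
    exact norm_le_maxModulus hf ih

theorem tendsto_iterate_maxModulus (hf : Differentiable ℂ f) (hR : 0 < R)
    (hM : ∀ r : ℝ, R ≤ r → r < maxModulus f r) {s : ℝ} (hs : R ≤ s) :
    Tendsto (fun n => (maxModulus f)^[n] s) atTop atTop := by
  have hmono := iterate_maxModulus_mono_nat hM hs
  rcases tendsto_atTop_of_monotone hmono with h | ⟨l, hl⟩
  · exact h
  exfalso
  have hle : ∀ n, (maxModulus f)^[n] s ≤ l := fun n => hmono.ge_of_tendsto hl n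
  have hRl : R ≤ l := hs.trans (hle 0)
  have hl0 : 0 < l := hR.trans_le hRl
  obtain ⟨z, hz, hz'⟩ := exists_norm_eq_maxModulus hf.continuous hl0.le
  have hlt := hM l hRl
  -- points near `z` on the circles of radius `Mⁿ(s)`
  have hlim : Tendsto (fun n => ‖f (((maxModulus f)^[n] s / l : ℝ) * z)‖) atTop
      (𝓝 (maxModulus f l)) := by
    rw [← hz']
    have h1 : Tendsto (fun n => (((maxModulus f)^[n] s / l : ℝ) : ℂ) * z) atTop (𝓝 z) := by
      have h2 : Tendsto (fun n => (maxModulus f)^[n] s / l) atTop (𝓝 1) := by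
        have := hl.div_const l
        rwa [div_self hl0.ne'] at this
      have h3 := (Complex.continuous_ofReal.tendsto 1).comp h2
      simpa using h3.mul_const z
    exact (hf.continuous.norm.tendsto z).comp h1
  refine absurd (le_of_tendsto' hlim fun n => ?_) (not_le.2 hlt)
  refine le_trans ?_ (hle (n + 1))
  rw [Function.iterate_succ_apply']
  refine norm_le_maxModulus hf ?_
  have h0 : 0 ≤ (maxModulus f)^[n] s := hR.le.trans (hs.trans (le_iterate_maxModulus hM hs n))
  rw [norm_mul, Complex.norm_real, Real.norm_of_nonneg (by positivity), hz,
    div_mul_cancel₀ _ hl0.ne']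

/-- The iterates of `M` drive different starting values apart. -/
theorem exists_mul_iterate_lt (hf : IsTranscendentalEntire f) (hR : 0 < R)
    (hM : ∀ r : ℝ, R ≤ r → r < maxModulus f r) {a b : ℝ} (ha : 0 ≤ a) (hab : a < b) (hb : R ≤ b)
    (C : ℝ) : ∀ᶠ n in atTop, C * (maxModulus f)^[n] a < (maxModulus f)^[n] b := by
  obtain ⟨r₀, hr₀, hmono⟩ := hf.exists_div_sq_mono
  obtain ⟨N, hN⟩ := ((tendsto_iterate_maxModulus hf.1 hR hM hb).eventually_gt_atTop
    (max r₀ R)).exists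
  have hstrict : ∀ n, 0 ≤ (maxModulus f)^[n] a ∧
      (maxModulus f)^[n] a < (maxModulus f)^[n] b := by
    intro n
    induction n with
    | zero => exact ⟨ha, hab⟩
    | succ n ih =>
      refine ⟨(iterate_maxModulus_mono hf.1 ha hab.le (n + 1)).1, ?_⟩
      simp only [Function.iterate_succ_apply']
      exact maxModulus_strictMono hf ih.1 ih.2
  set S := (maxModulus f)^[N] b with hS
  set s := max ((maxModulus f)^[N] a) (max r₀ R) with hs
  have hsS : s < S := max_lt (hstrict N).2 hN
  have hsr : r₀ ≤ s := (le_max_left _ _).trans (le_max_right _ _)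
  have hsR : R ≤ s := (le_max_right _ _).trans (le_max_right _ _)
  have hs0 : 0 < s := hR.trans_le hsR
  have hratio : ∀ k, 0 < (maxModulus f)^[k] s ∧
      (S / s) ^ (2 ^ k) * (maxModulus f)^[k] s ≤ (maxModulus f)^[k] S := by
    intro k
    induction k with
    | zero => exact ⟨hs0, by simp [div_mul_cancel₀ _ hs0.ne']⟩
    | succ k ih =>
      set x := (maxModulus f)^[k] s with hx
      set y := (maxModulus f)^[k] S with hy
      have hxs : s ≤ x := le_iterate_maxModulus hM hsR k
      have hxy : x ≤ y := (iterate_maxModulus_mono hf.1 hs0.le hsS.le k).2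
      have hy0 : 0 < y := ih.1.trans_le hxy
      have hMx : 0 < maxModulus f x := ih.1.trans (hM x (hsR.trans hxs))
      have h1 := hmono x y (hsr.trans hxs) hxy
      rw [div_le_div_iff₀ (by have := ih.1; positivity) (by positivity)] at h1
      simp only [Function.iterate_succ_apply', ← hx, ← hy]
      refine ⟨hMx, ?_⟩
      have h2 : ((S / s) ^ (2 ^ k) * x) ^ 2 ≤ y ^ 2 := by
        have : 0 ≤ (S / s) ^ (2 ^ k) * x := by
          have h3 := ih.1
          have h4 := hs0.trans hsS
          positivity
        gcongr
        exact ih.2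
      have hx2 : 0 < x ^ 2 := by have := ih.1; positivity
      rw [mul_pow, ← pow_mul, ← pow_succ] at h2
      have h3 : (S / s) ^ 2 ^ (k + 1) * maxModulus f x * x ^ 2 ≤ maxModulus f y * x ^ 2 := by
        calc (S / s) ^ 2 ^ (k + 1) * maxModulus f x * x ^ 2
            = maxModulus f x * ((S / s) ^ 2 ^ (k + 1) * x ^ 2) := by ring
          _ ≤ maxModulus f x * y ^ 2 := by gcongr
          _ ≤ maxModulus f y * x ^ 2 := h1
      exact le_of_mul_le_mul_right h3 hx2
  have hone : 1 < S / s := (one_lt_div hs0).2 hsS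
  have hpow : ∀ᶠ k : ℕ in atTop, C < (S / s) ^ (2 ^ k) := by
    have h1 : Tendsto (fun k : ℕ => (S / s) ^ (2 ^ k)) atTop atTop :=
      (tendsto_pow_atTop_atTop_of_one_lt hone).comp
        (tendsto_pow_atTop_atTop_of_one_lt (by norm_num : 1 < 2))
    exact h1.eventually_gt_atTop C
  obtain ⟨k₀, hk₀⟩ := eventually_atTop.1 hpow
  filter_upwards [eventually_ge_atTop (N + k₀)] with n hn
  obtain ⟨k, rfl⟩ := Nat.exists_eq_add_of_le (show N ≤ n by omega)
  have e1 : (maxModulus f)^[N + k] b = (maxModulus f)^[k] S := by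
    rw [add_comm, Function.iterate_add_apply]
  have e2 : (maxModulus f)^[N + k] a ≤ (maxModulus f)^[k] s := by
    rw [add_comm, Function.iterate_add_apply]
    exact (iterate_maxModulus_mono hf.1 (hstrict N).1 (le_max_left _ _) k).2
  have e3 := (iterate_maxModulus_mono hf.1 ha hab.le (N + k)).1
  have hCk := hk₀ k (by omega)
  obtain ⟨h1, h2⟩ := hratio k
  rw [e1]
  rcases le_or_gt C 0 with hC | hC
  · have h3 : C * (maxModulus f)^[N + k] a ≤ 0 := mul_nonpos_of_nonpos_of_nonneg hC e3
    have h4 : 0 < (maxModulus f)^[k] S :=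
      h1.trans_le (iterate_maxModulus_mono hf.1 hs0.le hsS.le k).2
    linarith
  · calc C * (maxModulus f)^[N + k] a ≤ C * (maxModulus f)^[k] s := by gcongr
      _ < (S / s) ^ (2 ^ k) * (maxModulus f)^[k] s := by gcongr
      _ ≤ _ := h2

end Iterates

theorem IsTranscendentalEntire.isOpenMap (hf : IsTranscendentalEntire f) : IsOpenMap f := by
  have han : AnalyticOnNhd ℂ f univ := fun x _ => hf.1.analyticAt x
  rcases han.is_constant_or_isOpenMap with ⟨w, hw⟩ | h
  · obtain ⟨z, hz⟩ := hf.not_const w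
    exact absurd (hw z) hz
  · exact h

theorem IsTranscendentalEntire.isOpenMap_iterate (hf : IsTranscendentalEntire f) (n : ℕ) :
    IsOpenMap f^[n] := by
  induction n with
  | zero => exact IsOpenMap.id
  | succ n ih => exact ih.comp hf.isOpenMap

theorem IsNormalFamilyOn.mono {F : ℕ → ℂ → ℂ} {U V : Set ℂ} (h : IsNormalFamilyOn F U)
    (hVU : V ⊆ U) : IsNormalFamilyOn F V := by
  intro φ
  obtain ⟨ψ, hψ, h | h⟩ := h φ
  · obtain ⟨g, hg⟩ := h
    exact ⟨ψ, hψ, Or.inl ⟨g, hg.mono hVU⟩⟩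
  · exact ⟨ψ, hψ, Or.inr fun K hK => h K (hK.trans hVU)⟩

theorem isOpen_fatouSet (f : ℂ → ℂ) : IsOpen (fatouSet f) := by
  rw [Metric.isOpen_iff]
  rintro z ⟨r, hr, h⟩
  refine ⟨r, hr, fun w hw => ?_⟩
  have hw' : dist w z < r := hw
  exact ⟨r - dist w z, by linarith, h.mono (Metric.ball_subset_ball' (by linarith))⟩

theorem isClosed_juliaSet (f : ℂ → ℂ) : IsClosed (juliaSet f) :=
  (isOpen_fatouSet f).isClosed_compl

theorem apply_mem_fatouSet (hf : IsTranscendentalEntire f) {z : ℂ} (hz : z ∈ fatouSet f) :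
    f z ∈ fatouSet f := by
  obtain ⟨r, hr, h⟩ := hz
  have hK : Metric.closedBall z (r / 2) ⊆ Metric.ball z r :=
    Metric.closedBall_subset_ball (by linarith)
  have hKc : IsCompact (Metric.closedBall z (r / 2)) := isCompact_closedBall _ _
  obtain ⟨ρ, hρ, hV⟩ := Metric.isOpen_iff.1 (hf.isOpenMap _ Metric.isOpen_ball) (f z)
    ⟨z, Metric.mem_ball_self (half_pos hr), rfl⟩
  have hpre : ∀ w ∈ Metric.ball (f z) ρ, ∃ x ∈ Metric.closedBall z (r / 2), f x = w := by
    intro w hw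
    obtain ⟨x, hx, rfl⟩ := hV hw
    exact ⟨x, Metric.ball_subset_closedBall hx, rfl⟩
  refine ⟨ρ, hρ, fun φ => ?_⟩
  obtain ⟨ψ, hψ, h | h⟩ := h fun n => φ n + 1
  · obtain ⟨g, hg⟩ := h
    choose! x hx hfx using hpre
    refine ⟨ψ, hψ, Or.inl ⟨fun w => g (x w), TendstoUniformlyOn.tendstoLocallyUniformlyOn ?_⟩⟩
    have hu : TendstoUniformlyOn (fun n => f^[φ (ψ n) + 1]) g atTop (Metric.closedBall z (r / 2)) :=
      (tendstoLocallyUniformlyOn_iff_tendstoUniformlyOn_of_compact hKc).1 (hg.mono hK)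
    rw [Metric.tendstoUniformlyOn_iff] at hu ⊢
    intro ε hε
    filter_upwards [hu ε hε] with n hn w hw
    have := hn (x w) (hx w hw)
    rwa [Function.iterate_succ_apply, hfx w hw] at this
  · refine ⟨ψ, hψ, Or.inr fun K hKsub _ C => ?_⟩
    filter_upwards [h _ hK hKc C] with n hn w hw
    obtain ⟨x, hx, rfl⟩ := hpre w (hKsub hw)
    exact hn x hx

theorem mem_fatouSet_of_apply (hf : Continuous f) {z : ℂ} (hz : f z ∈ fatouSet f) :
    z ∈ fatouSet f := by
  obtain ⟨r, hr, h⟩ := hz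
  obtain ⟨δ, hδ, hsub⟩ := Metric.isOpen_iff.1 (Metric.isOpen_ball.preimage hf) z
    (Metric.mem_ball_self hr : f z ∈ Metric.ball (f z) r)
  refine ⟨δ, hδ, fun φ => ?_⟩
  by_cases hfreq : ∃ᶠ n in atTop, φ n = 0
  · obtain ⟨ψ, hψ, h0⟩ := extraction_of_frequently_atTop hfreq
    refine ⟨ψ, hψ, Or.inl ⟨id, TendstoUniformlyOn.tendstoLocallyUniformlyOn ?_⟩⟩
    rw [Metric.tendstoUniformlyOn_iff]
    intro ε hε
    refine Eventually.of_forall fun n x _ => ?_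
    simp [h0 n, hε]
  · rw [not_frequently] at hfreq
    obtain ⟨N, hN⟩ := eventually_atTop.1 hfreq
    have hit : ∀ n x, f^[φ (n + N)] x = f^[φ (n + N) - 1] (f x) := by
      intro n x
      rw [← Function.iterate_succ_apply, Nat.succ_eq_add_one, Nat.sub_add_cancel]
      exact Nat.one_le_iff_ne_zero.2 (hN _ (by omega))
    obtain ⟨ψ, hψ, h⟩ := h fun n => φ (n + N) - 1
    refine ⟨fun n => ψ n + N, fun a b hab => by simpa using hψ hab, h.imp ?_ ?_⟩
    · rintro ⟨g, hg⟩
      refine ⟨g ∘ f, ?_⟩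
      have := hg.comp f hsub hf.continuousOn
      refine this.congr fun n x _ => ?_
      exact (hit _ _).symm
    · intro h K hK hKc C
      filter_upwards [h (f '' K) (by rintro _ ⟨x, hx, rfl⟩; exact hsub (hK hx)) (hKc.image hf) C]
        with n hn x hx
      rw [hit]
      exact hn _ ⟨x, hx, rfl⟩

theorem iterate_mem_fatouSet_iff (hf : IsTranscendentalEntire f) {z : ℂ} (n : ℕ) :
    f^[n] z ∈ fatouSet f ↔ z ∈ fatouSet f := by
  induction n with
  | zero => rfl
  | succ n ih =>
    rw [Function.iterate_succ_apply', ← ih]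
    exact ⟨mem_fatouSet_of_apply hf.1.continuous, apply_mem_fatouSet hf⟩

theorem iterate_mem_juliaSet_iff (hf : IsTranscendentalEntire f) {z : ℂ} (n : ℕ) :
    f^[n] z ∈ juliaSet f ↔ z ∈ juliaSet f :=
  not_congr (iterate_mem_fatouSet_iff hf n)

section Components

variable {U : Set ℂ}

theorem IsFatouComponent.isOpen (hU : IsFatouComponent f U) : IsOpen U := by
  obtain ⟨z, -, rfl⟩ := hU
  exact (isOpen_fatouSet f).connectedComponentIn

theorem IsFatouComponent.isPreconnected (hU : IsFatouComponent f U) : IsPreconnected U := by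
  obtain ⟨z, -, rfl⟩ := hU
  exact isPreconnected_connectedComponentIn

theorem IsFatouComponent.subset (hU : IsFatouComponent f U) : U ⊆ fatouSet f := by
  obtain ⟨z, -, rfl⟩ := hU
  exact connectedComponentIn_subset _ _

theorem IsFatouComponent.eq_of_mem (hU : IsFatouComponent f U) {z : ℂ} (hz : z ∈ U) :
    U = connectedComponentIn (fatouSet f) z := by
  obtain ⟨w, -, rfl⟩ := hU
  exact connectedComponentIn_eq hz

theorem IsFatouComponent.subset_of_inter (hU : IsFatouComponent f U) {S : Set ℂ}
    (hS : IsPreconnected S) (hSF : S ⊆ fatouSet f) (h : (S ∩ U).Nonempty) : S ⊆ U := by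
  obtain ⟨z, hzS, hzU⟩ := h
  rw [hU.eq_of_mem hzU]
  exact hS.subset_connectedComponentIn hzS hSF

theorem isFatouComponent_connectedComponentIn {z : ℂ} (hz : z ∈ fatouSet f) :
    IsFatouComponent f (connectedComponentIn (fatouSet f) z) := ⟨z, hz, rfl⟩

theorem IsFatouComponent.nonempty (hU : IsFatouComponent f U) : U.Nonempty := by
  obtain ⟨z, hz, rfl⟩ := hU
  exact ⟨z, mem_connectedComponentIn hz⟩

theorem IsFatouComponent.frontier_subset (hU : IsFatouComponent f U) :
    frontier U ⊆ juliaSet f := by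
  intro x hx hxF
  have hV := isFatouComponent_connectedComponentIn hxF
  have hxV := mem_connectedComponentIn hxF
  obtain ⟨y, hyV, hyU⟩ := mem_closure_iff.1 hx.1 _ hV.isOpen hxV
  have : x ∈ U := hU.subset_of_inter hV.isPreconnected hV.subset ⟨y, hyV, hyU⟩ hxV
  rw [hU.isOpen.frontier_eq] at hx
  exact hx.2 this

end Components

section Escaping

theorem tendsToInfty_of_mem_escapingSet {z w : ℂ} {r : ℝ}
    (h : IsNormalFamilyOn (fun n => f^[n]) (Metric.ball z r)) (hw : w ∈ Metric.ball z r)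
    (hesc : w ∈ escapingSet f) :
    TendsToInftyLocallyUniformlyOn (fun n => f^[n]) (Metric.ball z r) := by
  intro K hK hKc C
  by_contra hcon
  rw [not_eventually] at hcon
  obtain ⟨φ, hφ, hφC⟩ := extraction_of_frequently_atTop hcon
  obtain ⟨ψ, hψ, ⟨g, hg⟩ | h⟩ := h φ
  · have h1 := (hg.tendsto_at hw).norm
    have h2 : Tendsto (fun n => ‖f^[φ (ψ n)] w‖) atTop atTop :=
      hesc.comp (hφ.comp hψ).tendsto_atTop
    exact not_tendsto_atTop_of_tendsto_nhds h1 h2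
  · obtain ⟨n, hn⟩ := (h K hK hKc C).exists
    exact hφC _ hn

theorem subset_escapingSet {U : Set ℂ} (hU : IsPreconnected U) (hUF : U ⊆ fatouSet f) {w : ℂ}
    (hw : w ∈ U) (hesc : w ∈ escapingSet f) : U ⊆ escapingSet f := by
  intro x hx
  refine hU.induction₂' (fun x y => x ∈ escapingSet f → y ∈ escapingSet f) (fun z hz => ?_)
    (fun x y z _ _ _ h1 h2 h => h2 (h1 h)) hw hx hesc
  obtain ⟨r, hr, h⟩ := hUF hz
  refine eventually_nhdsWithin_of_eventually_nhds ?_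
  filter_upwards [Metric.ball_mem_nhds z hr] with y hy
  have key : ∀ x ∈ Metric.ball z r, ∀ y ∈ Metric.ball z r, x ∈ escapingSet f →
      y ∈ escapingSet f := by
    intro x hx y hy hxe
    refine tendsto_atTop.2 fun C => ?_
    filter_upwards [tendsToInfty_of_mem_escapingSet h hx hxe {y} (by simpa using hy)
      isCompact_singleton C] with n hn using hn y rfl
  exact ⟨key z (Metric.mem_ball_self hr) y hy, key y hy z (Metric.mem_ball_self hr)⟩

theorem exists_log_norm_iterate_le {U : Set ℂ} (hf : Differentiable ℂ f) (hU : IsPreconnected U)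
    (hUF : U ⊆ fatouSet f) (hesc : U ⊆ escapingSet f) {x y : ℂ} (hx : x ∈ U) (hy : y ∈ U) :
    ∃ C : ℝ, 0 ≤ C ∧ ∀ᶠ n in atTop, Real.log ‖f^[n] y‖ ≤ C * Real.log ‖f^[n] x‖ := by
  refine hU.induction₂' (fun x y => ∃ C : ℝ, 0 ≤ C ∧ ∀ᶠ n in atTop,
    Real.log ‖f^[n] y‖ ≤ C * Real.log ‖f^[n] x‖) (fun z hz => ?_) ?_ hx hy
  · obtain ⟨r, hr, h⟩ := hUF hz
    have hinf := tendsToInfty_of_mem_escapingSet h (Metric.mem_ball_self hr) (hesc hz)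
    have hev := hinf (Metric.closedBall z (r / 2)) (Metric.closedBall_subset_ball (by linarith))
      (isCompact_closedBall _ _) 2
    refine eventually_nhdsWithin_of_eventually_nhds ?_
    filter_upwards [Metric.ball_mem_nhds z (show (0 : ℝ) < r / 16 by positivity)] with y hy
    have key : ∀ a ∈ Metric.ball z (r / 16), ∀ b ∈ Metric.ball z (r / 16),
        ∃ C : ℝ, 0 ≤ C ∧ ∀ᶠ n in atTop, Real.log ‖f^[n] b‖ ≤ C * Real.log ‖f^[n] a‖ := by
      intro a ha b hb
      rw [Metric.mem_ball] at ha hb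
      refine ⟨3, by norm_num, ?_⟩
      filter_upwards [hev] with n hn
      have hsub : Metric.ball a (r / 2 - r / 8) ⊆ Metric.closedBall z (r / 2) :=
        (Metric.ball_subset_ball' (by linarith)).trans Metric.ball_subset_closedBall
      refine log_norm_le_three_mul (r := r / 2 - r / 8) (by linarith)
        (hf.iterate n).differentiableOn (fun w hw => ?_) ?_
      · linarith [hn w (hsub hw)]
      · rw [Metric.mem_closedBall]
        linarith [dist_triangle_right b a z]
    have hz0 := Metric.mem_ball_self (x := z) (show (0 : ℝ) < r / 16 by positivity)
    exact ⟨key z hz0 y hy, key y hy z hz0⟩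
  · rintro a b c - - - ⟨C₁, h1, h1'⟩ ⟨C₂, h2, h2'⟩
    refine ⟨C₂ * C₁, by positivity, ?_⟩
    filter_upwards [h1', h2'] with n hn1 hn2
    calc _ ≤ C₂ * Real.log ‖f^[n] b‖ := hn2
      _ ≤ C₂ * (C₁ * Real.log ‖f^[n] a‖) := by gcongr
      _ = _ := by ring

end Escaping

variable {R : ℝ}

theorem isClosed_fastEscapingLevel (hf : Continuous f) : IsClosed (fastEscapingLevel f R) := by
  have : fastEscapingLevel f R = ⋂ n : ℕ, {z | (maxModulus f)^[n] R ≤ ‖f^[n] z‖} := by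
    ext z
    simp [fastEscapingLevel]
  rw [this]
  exact isClosed_iInter fun n => isClosed_le continuous_const (hf.iterate n).norm

theorem fastEscapingLevel_subset_fastEscapingSet :
    fastEscapingLevel f R ⊆ fastEscapingSet f R := fun _ hz => ⟨0, hz⟩

theorem fastEscapingSet_subset_escapingSet (hf : Differentiable ℂ f) (hR : 0 < R)
    (hM : ∀ r : ℝ, R ≤ r → r < maxModulus f r) : fastEscapingSet f R ⊆ escapingSet f := by
  rintro z ⟨L, hL⟩
  exact (tendsto_add_atTop_iff_nat L).1
    (tendsto_atTop_mono hL (tendsto_iterate_maxModulus hf hR hM le_rfl))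

theorem mem_fastEscapingSet_iff {z : ℂ} :
    z ∈ fastEscapingSet f R ↔ ∃ L, f^[L] z ∈ fastEscapingLevel f R := by
  simp only [fastEscapingSet, fastEscapingLevel, mem_ofPred_eq, Function.iterate_add_apply]

theorem iterate_mem_fastEscapingLevel (hM : ∀ r : ℝ, R ≤ r → r < maxModulus f r) {z : ℂ}
    (hz : z ∈ fastEscapingLevel f R) (m : ℕ) : f^[m] z ∈ fastEscapingLevel f R := by
  intro n
  rw [← Function.iterate_add_apply]
  exact (iterate_maxModulus_mono_nat hM le_rfl (Nat.le_add_right n m)).trans (hz (n + m))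

/-- A connected subset of the Fatou set cannot join a point to a point escaping one step faster. -/
theorem not_fast_of_mem_fatou (hf : IsTranscendentalEntire f) (hR : 0 < R)
    (hM : ∀ r : ℝ, R ≤ r → r < maxModulus f r) {U : Set ℂ} (hU : IsPreconnected U)
    (hUF : U ⊆ fatouSet f) {s : ℝ} (hs : R ≤ s) {x y : ℂ} (hx : x ∈ U) (hy : y ∈ U) (hxs : ‖x‖ ≤ s)
    (hys : ∀ n, (maxModulus f)^[n + 1] s ≤ ‖f^[n] y‖) : False := by
  have htend := tendsto_iterate_maxModulus hf.1 hR hM hs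
  have hesc : U ⊆ escapingSet f := subset_escapingSet hU hUF hy
    (tendsto_atTop_mono hys ((tendsto_add_atTop_iff_nat 1).2 htend))
  obtain ⟨C, hC, hlog⟩ := exists_log_norm_iterate_le hf.1 hU hUF hesc hx hy
  obtain ⟨K, hK⟩ := exists_nat_ge C
  obtain ⟨n, hn1, hn2, hn3, hn4⟩ := (hlog.and ((htend.eventually (hf.eventually_pow_lt K)).and
    ((htend.eventually (eventually_gt_atTop 1)).and
      ((hesc hx).eventually (eventually_gt_atTop 1))))).exists
  set t := (maxModulus f)^[n] s with ht
  have h1 : maxModulus f t ≤ ‖f^[n] y‖ := by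
    have := hys n
    rwa [Function.iterate_succ_apply'] at this
  have h2 : ‖f^[n] x‖ ≤ t := norm_iterate_le hf.1 hxs n
  have h3 : Real.log (t ^ K) < Real.log ‖f^[n] y‖ :=
    Real.log_lt_log (by positivity) (hn2.trans_le h1)
  rw [Real.log_pow] at h3
  have h4 : Real.log ‖f^[n] x‖ ≤ Real.log t := Real.log_le_log (by linarith) h2
  have h5 : 0 ≤ Real.log ‖f^[n] x‖ := Real.log_nonneg hn4.le
  nlinarith [mul_le_mul hK h4 h5 (by positivity)]

/-- The image of a domain bounded by the level set `A_R(f)`. -/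
theorem ball_subset_image_iterate (hf : IsTranscendentalEntire f) (hR : 0 < R)
    {G : Set ℂ} (hGo : IsOpen G) (hGb : Bornology.IsBounded G) (hG0 : (0 : ℂ) ∈ G)
    (hGA : frontier G ⊆ fastEscapingLevel f R) (m : ℕ) :
    Metric.ball (0 : ℂ) ((maxModulus f)^[m] R) ⊆ f^[m] '' G ∧
      ∀ z ∈ frontier (f^[m] '' G), ∀ n, (maxModulus f)^[n + m] R ≤ ‖f^[n] z‖ := by
  have hcont := hf.1.continuous.iterate m
  have hWo : IsOpen (f^[m] '' G) := hf.isOpenMap_iterate m G hGo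
  have hcl : closure (f^[m] '' G) ⊆ f^[m] '' closure G :=
    closure_minimal (image_mono subset_closure)
      (hGb.isCompact_closure.image hcont).isClosed
  have hfr : ∀ z ∈ frontier (f^[m] '' G), ∀ n, (maxModulus f)^[n + m] R ≤ ‖f^[n] z‖ := by
    intro z hz n
    rw [hWo.frontier_eq] at hz
    obtain ⟨x, hx, rfl⟩ := hcl hz.1
    have hxG : x ∉ G := fun h => hz.2 ⟨x, h, rfl⟩
    have hxA := hGA (by rw [hGo.frontier_eq]; exact ⟨hx, hxG⟩) (n + m)
    rw [← Function.iterate_add_apply]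
    exact hxA
  refine ⟨?_, hfr⟩
  have hball : ∀ (W : Set ℂ) (ρ : ℝ), (∀ z ∈ frontier W, ρ ≤ ‖z‖) →
      (Metric.ball (0 : ℂ) ρ ∩ W).Nonempty → Metric.ball (0 : ℂ) ρ ⊆ W := by
    intro W ρ h hne x hx
    by_contra hxW
    obtain ⟨y, hy, hy'⟩ := inter_frontier_nonempty (convex_ball (0 : ℂ) ρ).isPreconnected hne
      ⟨x, hx, hxW⟩
    have := h y hy'
    rw [mem_ball_zero_iff] at hy
    linarith
  have hGR : Metric.ball (0 : ℂ) R ⊆ G := hball G R (fun z hz => hGA hz 0)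
    ⟨0, Metric.mem_ball_self hR, hG0⟩
  refine hball _ _ (fun z hz => by simpa using hfr z hz 0) ?_
  refine ⟨f^[m] 0, ?_, 0, hG0, rfl⟩
  have hsub : f^[m] '' Metric.ball 0 R ⊆ Metric.closedBall 0 ((maxModulus f)^[m] R) := by
    rintro _ ⟨x, hx, rfl⟩
    rw [mem_closedBall_zero_iff]
    exact norm_iterate_le hf.1 (mem_ball_zero_iff.1 hx).le m
  have hint := interior_maximal hsub (hf.isOpenMap_iterate m _ Metric.isOpen_ball)
    ⟨0, Metric.mem_ball_self hR, rfl⟩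
  have hne : (maxModulus f)^[m] R ≠ 0 := by
    intro h0
    rw [h0, Metric.closedBall_zero, interior_singleton] at hint
    exact hint
  rwa [interior_closedBall _ hne] at hint

theorem IsSpidersWeb.exists_mem_zero {E : Set ℂ} (h : IsSpidersWeb E) : ∃ G : Set ℂ, IsOpen G ∧
    Bornology.IsBounded G ∧ (0 : ℂ) ∈ G ∧ frontier G ⊆ E := by
  obtain ⟨-, G, hG, -, hfr, hU⟩ := h
  obtain ⟨k, hk⟩ := mem_iUnion.1 (hU ▸ mem_univ (0 : ℂ))
  exact ⟨G k, (hG k).1, (hG k).2.2, hk, hfr k⟩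

/-- Connected subsets of the Fatou set meeting a given disc are uniformly bounded. -/
theorem exists_isBounded_of_inter (hf : IsTranscendentalEntire f) (hR : 0 < R)
    (hM : ∀ r : ℝ, R ≤ r → r < maxModulus f r) (hweb : IsSpidersWeb (fastEscapingLevel f R))
    (s : ℝ) : ∃ B : Set ℂ, Bornology.IsBounded B ∧ ∀ U : Set ℂ, IsPreconnected U →
      U ⊆ fatouSet f → (U ∩ Metric.closedBall 0 s).Nonempty → U ⊆ B := by
  obtain ⟨G, hGo, hGb, hG0, hGA⟩ := hweb.exists_mem_zero
  obtain ⟨m, hm⟩ := ((tendsto_iterate_maxModulus hf.1 hR hM le_rfl).eventually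
    (eventually_ge_atTop s)).exists
  have hRm := le_iterate_maxModulus hM le_rfl m
  obtain ⟨hball, hfr⟩ := ball_subset_image_iterate hf hR hGo hGb hG0 hGA (m + 1)
  refine ⟨f^[m + 1] '' G, ?_, fun U hU hUF hne => ?_⟩
  · exact (hGb.isCompact_closure.image (hf.1.continuous.iterate (m + 1))).isBounded.subset
      (image_mono subset_closure)
  · obtain ⟨x, hxU, hxs⟩ := hne
    rw [mem_closedBall_zero_iff] at hxs
    have hxW : x ∈ f^[m + 1] '' G := by
      refine hball ?_
      rw [mem_ball_zero_iff, Function.iterate_succ_apply']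
      exact (hxs.trans hm).trans_lt (hM _ hRm)
    intro y hy
    by_contra hyW
    obtain ⟨w, hwU, hw⟩ := inter_frontier_nonempty hU ⟨x, hxU, hxW⟩ ⟨y, hy, hyW⟩
    refine not_fast_of_mem_fatou hf hR hM hU hUF hRm hxU hwU (hxs.trans hm) fun n => ?_
    rw [← Function.iterate_add_apply]
    have := hfr w hw n
    rwa [show n + 1 + m = n + (m + 1) by ring]

theorem IsFatouComponent.isBounded (hf : IsTranscendentalEntire f) (hR : 0 < R)
    (hM : ∀ r : ℝ, R ≤ r → r < maxModulus f r) (hweb : IsSpidersWeb (fastEscapingLevel f R))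
    {U : Set ℂ} (hU : IsFatouComponent f U) : Bornology.IsBounded U := by
  obtain ⟨x, hx⟩ := hU.nonempty
  obtain ⟨B, hB, h⟩ := exists_isBounded_of_inter hf hR hM hweb ‖x‖
  exact hB.subset (h U hU.isPreconnected hU.subset ⟨x, hx, by simp⟩)

theorem juliaSet_nonempty (hf : IsTranscendentalEntire f) (hR : 0 < R)
    (hM : ∀ r : ℝ, R ≤ r → r < maxModulus f r) (hweb : IsSpidersWeb (fastEscapingLevel f R)) :
    (juliaSet f).Nonempty := by
  by_contra h
  have hF : fatouSet f = univ := by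
    rw [not_nonempty_iff_eq_empty, juliaSet, compl_empty_iff] at h
    exact h
  have hU : IsFatouComponent f univ := ⟨0, by simp [hF], by
    rw [hF, connectedComponentIn_univ, PreconnectedSpace.connectedComponent_eq_univ]⟩
  exact NormedSpace.unbounded_univ ℂ ℂ (hU.isBounded hf hR hM hweb)

/-- A holomorphic function omitting `a` on a disc with values in a simply connected domain is
distorted by at most a bounded factor. -/
theorem norm_sub_le_of_mapsTo {V : Set ℂ} (hVo : IsOpen V) (hV : IsSimplyConnected V) {a : ℂ}
    (ha : a ∉ V) {g : ℂ → ℂ} {c : ℂ} {r : ℝ} (hr : 0 < r)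
    (hg : DifferentiableOn ℂ g (Metric.ball c r)) (hgV : MapsTo g (Metric.ball c r) V)
    {x y : ℂ} (hx : x ∈ Metric.ball c (r / 2)) (hy : y ∈ Metric.ball c (r / 2)) :
    ‖g y - a‖ ≤ Real.exp (400 * Real.pi) * ‖g x - a‖ := by
  obtain ⟨ℓ, hℓ, he⟩ := Complex.exists_continuousOn_eqOn_exp_comp (g := fun w => w - a) hV hVo
    (by fun_prop) (by
      rintro ⟨w, hw, h0⟩
      rw [sub_eq_zero.1 h0] at hw
      exact ha hw)
  have he' : ∀ w ∈ V, Complex.exp (ℓ w) = w - a := he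
  set h : ℂ → ℂ := fun z => ℓ (g z) with hh
  have hexp : ∀ z ∈ Metric.ball c r, Complex.exp (h z) = g z - a := fun z hz => he' _ (hgV hz)
  have hd : DifferentiableOn ℂ h (Metric.ball c r) :=
    differentiableOn_of_exp Metric.isOpen_ball (hg.sub_const a)
      (hℓ.comp hg.continuousOn hgV) hexp
  have hderiv : ∀ z ∈ Metric.ball c (r / 2), ‖deriv h z‖ ≤ 400 * Real.pi / r := by
    intro z hz
    by_contra! hlt
    have hpi := Real.pi_pos
    have hne : deriv h z ≠ 0 := by
      rintro h0
      rw [h0, norm_zero] at hlt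
      have : 0 < 400 * Real.pi / r := by positivity
      linarith
    have hsub : Metric.ball z (r / 2) ⊆ Metric.ball c r := by
      refine Metric.ball_subset_ball' ?_
      rw [Metric.mem_ball] at hz
      linarith
    obtain ⟨p, hp⟩ := exists_ball_subset_image (half_pos hr) (hd.mono hsub) hne
    have hrad : 2 * Real.pi < ‖deriv h z‖ * (r / 2) / 96 := by
      rw [div_lt_iff₀ hr] at hlt
      linarith
    obtain ⟨u, hu, hu'⟩ := hp (Metric.mem_ball_self (x := h p) (by linarith))
    obtain ⟨v, hv, hv'⟩ := hp (show h p + 2 * Real.pi * Complex.I ∈ _ by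
      rw [Metric.mem_ball, dist_eq_norm, add_sub_cancel_left]
      simpa [abs_of_pos hpi] using hrad)
    have h1 : g u = g v := by
      have : g u - a = g v - a := by
        rw [← hexp u (hsub hu), ← hexp v (hsub hv), hu', hv', Complex.exp_add,
          Complex.exp_two_pi_mul_I, mul_one]
      exact sub_left_injective this
    have h2 : h p = h p + 2 * Real.pi * Complex.I :=
      hu'.symm.trans ((congrArg ℓ h1).trans hv')
    have h3 : (2 * Real.pi * Complex.I : ℂ) = 0 := by
      rw [left_eq_add] at h2
      exact h2
    exact Complex.two_pi_I_ne_zero h3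
  have hsub : Metric.ball c (r / 2) ⊆ Metric.ball c r := Metric.ball_subset_ball (by linarith)
  have hdist : ‖h y - h x‖ ≤ 400 * Real.pi := by
    have h1 := (convex_ball c (r / 2)).norm_image_sub_le_of_norm_deriv_le
      (fun z hz => hd.differentiableAt (Metric.isOpen_ball.mem_nhds (hsub hz))) hderiv hx hy
    have h2 : ‖y - x‖ ≤ r := by
      rw [← dist_eq_norm]
      rw [Metric.mem_ball] at hx hy
      linarith [dist_triangle_right y x c]
    calc _ ≤ _ := h1
      _ ≤ 400 * Real.pi / r * r := by gcongr
      _ = _ := by field_simp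
  rw [← hexp x (hsub hx), ← hexp y (hsub hy), Complex.norm_exp, Complex.norm_exp, ← Real.exp_add,
    Real.exp_le_exp]
  have := (Complex.abs_re_le_norm (h y - h x)).trans hdist
  rw [Complex.sub_re, abs_le] at this
  linarith [this.2]

/-- If all Fatou components are simply connected, then a component meeting `A_R(f)` lies in it
together with its closure. -/
theorem closure_subset_fastEscapingLevel (hf : IsTranscendentalEntire f) (hR : 0 < R)
    (hM : ∀ r : ℝ, R ≤ r → r < maxModulus f r) (hJ : (juliaSet f).Nonempty)
    (hsc : ∀ U : Set ℂ, IsFatouComponent f U → IsSimplyConnected U) {U : Set ℂ}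
    (hU : IsFatouComponent f U) (hne : (U ∩ fastEscapingLevel f R).Nonempty) :
    closure U ⊆ fastEscapingLevel f R := by
  refine closure_minimal (fun z hz m => ?_) (isClosed_fastEscapingLevel hf.1.continuous)
  obtain ⟨x, hxU, hxA⟩ := hne
  obtain ⟨a, ha⟩ := hJ
  have hesc : U ⊆ escapingSet f := subset_escapingSet hU.isPreconnected hU.subset hxU
    (fastEscapingSet_subset_escapingSet hf.1 hR hM (fastEscapingLevel_subset_fastEscapingSet hxA))
  obtain ⟨C, hC, hCn⟩ : ∃ C : ℝ, 0 ≤ C ∧ ∀ n, ‖f^[n] x - a‖ ≤ C * ‖f^[n] z - a‖ := by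
    refine hU.isPreconnected.induction₂' (fun x y => ∃ C : ℝ, 0 ≤ C ∧
      ∀ n, ‖f^[n] y - a‖ ≤ C * ‖f^[n] x - a‖) (fun c hc => ?_) ?_ hz hxU
    · obtain ⟨r, hr, hball⟩ := Metric.isOpen_iff.1 hU.isOpen c hc
      refine eventually_nhdsWithin_of_eventually_nhds ?_
      filter_upwards [Metric.ball_mem_nhds c (half_pos hr)] with y hy
      have key : ∀ u ∈ Metric.ball c (r / 2), ∀ v ∈ Metric.ball c (r / 2),
          ∃ C : ℝ, 0 ≤ C ∧ ∀ n, ‖f^[n] v - a‖ ≤ C * ‖f^[n] u - a‖ := by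
        intro u hu v hv
        refine ⟨_, (Real.exp_pos (400 * Real.pi)).le, fun n => ?_⟩
        have hcF : f^[n] c ∈ fatouSet f := (iterate_mem_fatouSet_iff hf n).2 (hU.subset hc)
        have hV := isFatouComponent_connectedComponentIn hcF
        refine norm_sub_le_of_mapsTo hV.isOpen (hsc _ hV) (fun h => ha (hV.subset h)) hr
          (hf.1.iterate n).differentiableOn ?_ hu hv
        intro w hw
        refine hV.subset_of_inter (S := f^[n] '' Metric.ball c r) ?_ ?_ ?_ ⟨w, hw, rfl⟩
        · exact (convex_ball c r).isPreconnected.image _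
            (hf.1.continuous.iterate n).continuousOn
        · rintro _ ⟨w, hw, rfl⟩
          exact (iterate_mem_fatouSet_iff hf n).2 (hU.subset (hball hw))
        · exact ⟨f^[n] c, ⟨c, Metric.mem_ball_self hr, rfl⟩, mem_connectedComponentIn hcF⟩
      have hc0 := Metric.mem_ball_self (x := c) (half_pos hr)
      exact ⟨key c hc0 y hy, key y hy c hc0⟩
    · rintro u v w - - - ⟨C₁, h1, h1'⟩ ⟨C₂, h2, h2'⟩
      refine ⟨C₂ * C₁, by positivity, fun n => ?_⟩
      calc _ ≤ C₂ * ‖f^[n] v - a‖ := h2' n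
        _ ≤ C₂ * (C₁ * ‖f^[n] u - a‖) := by gcongr; exact h1' n
        _ = _ := by ring
  by_contra! hlt
  have hb := le_iterate_maxModulus hM le_rfl m
  have hlim := exists_mul_iterate_lt hf hR hM (norm_nonneg _) hlt hb (1 + 2 * C)
  have hza := (tendsto_add_atTop_iff_nat m).2 (hesc hz)
  obtain ⟨n, hn1, hn2⟩ := (hlim.and (hza.eventually (eventually_ge_atTop ‖a‖))).exists
  have h1 : ‖f^[n + m] z‖ ≤ (maxModulus f)^[n] ‖f^[m] z‖ := by
    rw [Function.iterate_add_apply]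
    exact norm_iterate_le hf.1 le_rfl n
  have h2 : (maxModulus f)^[n] ((maxModulus f)^[m] R) ≤ ‖f^[n + m] x‖ := by
    rw [← Function.iterate_add_apply]
    exact hxA (n + m)
  have h3 : ‖f^[n + m] x‖ ≤ ‖f^[n + m] x - a‖ + ‖a‖ := by
    simpa using norm_add_le (f^[n + m] x - a) a
  have h4 : ‖f^[n + m] z - a‖ ≤ ‖f^[n + m] z‖ + ‖a‖ := norm_sub_le _ _
  have h5 := hCn (n + m)
  have h6 : C * ‖f^[n + m] z - a‖ ≤ C * (‖f^[n + m] z‖ + ‖f^[n + m] z‖) := by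
    gcongr
    linarith
  have h7 : (1 + 2 * C) * ‖f^[n + m] z‖ ≤ (1 + 2 * C) * (maxModulus f)^[n] ‖f^[m] z‖ := by
    gcongr
  linarith

theorem frontier_nonempty_of_isBounded {G : Set ℂ} (hG : Bornology.IsBounded G)
    (hne : G.Nonempty) : (frontier G).Nonempty := by
  have hcompl : Gᶜ.Nonempty := by
    rw [nonempty_compl]
    rintro rfl
    exact NormedSpace.unbounded_univ ℂ ℂ hG
  obtain ⟨x, -, hx⟩ := inter_frontier_nonempty (G := G) isPreconnected_univ
    (by rwa [univ_inter]) (by rwa [univ_inter])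
  exact ⟨x, hx⟩

theorem isSpidersWeb_of_forall_exists {E : Set ℂ} (hE : IsConnected E)
    (h : ∀ s : ℝ, ∃ G, IsOpen G ∧ IsSimplyConnected G ∧ Bornology.IsBounded G ∧
      Metric.closedBall 0 s ⊆ G ∧ frontier G ⊆ E) : IsSpidersWeb E := by
  choose G hGo hGs hGb hGsub hGE using h
  have hb : ∀ s, ∃ b, G s ⊆ Metric.closedBall 0 b := fun s => (hGb s).subset_closedBall 0
  choose b hb using hb
  let ρ : ℕ → ℝ := Nat.rec 0 fun n t => max (n + 1) (b t)
  have hρ : ∀ n, ρ (n + 1) = max ((n : ℝ) + 1) (b (ρ n)) := fun n => rfl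
  have hρn : ∀ n : ℕ, (n : ℝ) ≤ ρ n := by
    rintro (_ | n)
    · simp [ρ]
    · rw [hρ]
      push_cast
      exact le_max_left _ _
  refine ⟨hE, fun n => G (ρ n), fun n => ⟨hGo _, hGs _, hGb _⟩, fun n => ?_, fun n => hGE _, ?_⟩
  · refine (hb (ρ n)).trans (Subset.trans (Metric.closedBall_subset_closedBall ?_) (hGsub _))
    rw [hρ]
    exact le_max_right _ _
  · refine eq_univ_of_forall fun z => mem_iUnion.2 ?_
    obtain ⟨n, hn⟩ := exists_nat_ge ‖z‖
    exact ⟨n, hGsub _ (mem_closedBall_zero_iff.2 (hn.trans (hρn n)))⟩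

theorem IsSpidersWeb.exists_closedBall_subset {E : Set ℂ} (h : IsSpidersWeb E) (s : ℝ) :
    ∃ G : Set ℂ, IsOpen G ∧ IsConnected G ∧ Bornology.IsBounded G ∧ Metric.closedBall 0 s ⊆ G ∧
      frontier G ⊆ E := by
  obtain ⟨-, G, hG, hmono, hfr, hU⟩ := h
  obtain ⟨k, hk⟩ := (isCompact_closedBall (0 : ℂ) s).elim_directed_cover G (fun n => (hG n).1)
    (by rw [hU]; exact subset_univ _) (monotone_nat_of_le_succ hmono).directed_le
  exact ⟨G k, (hG k).1, (hG k).2.1.isPathConnected.isConnected, (hG k).2.2, hk, hfr k⟩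

/-- Boundaries of the domains of the web `A_R(f)` can be moved into the Julia set. -/
theorem exists_frontier_subset_inter_juliaSet (hf : IsTranscendentalEntire f) (hR : 0 < R)
    (hM : ∀ r : ℝ, R ≤ r → r < maxModulus f r) (hweb : IsSpidersWeb (fastEscapingLevel f R))
    (hsc : ∀ U : Set ℂ, IsFatouComponent f U → IsSimplyConnected U) (s : ℝ) :
    ∃ G, IsOpen G ∧ IsSimplyConnected G ∧ Bornology.IsBounded G ∧ Metric.closedBall 0 s ⊆ G ∧
      frontier G ⊆ fastEscapingLevel f R ∩ juliaSet f := by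
  have hJ := juliaSet_nonempty hf hR hM hweb
  obtain ⟨G, hGo, hGc, hGb, hGs, hGA⟩ := hweb.exists_closedBall_subset s
  set 𝒰 : Set (Set ℂ) := {U | IsFatouComponent f U ∧ (U ∩ frontier G).Nonempty} with h𝒰
  have hUA : ∀ U ∈ 𝒰, U ⊆ fastEscapingLevel f R := by
    rintro U ⟨hU, x, hxU, hxG⟩
    exact subset_closure.trans (closure_subset_fastEscapingLevel hf hR hM hJ hsc hU
      ⟨x, hxU, hGA hxG⟩)
  set V : Set ℂ := G ∪ ⋃₀ 𝒰 with hV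
  have hVo : IsOpen V := hGo.union (isOpen_sUnion fun U hU => hU.1.isOpen)
  have hVc : IsConnected V := by
    obtain ⟨x, hx⟩ := hGc.nonempty
    refine ⟨⟨x, Or.inl hx⟩, isPreconnected_of_forall x ?_⟩
    rintro y (hy | ⟨U, hU, hyU⟩)
    · exact ⟨G, subset_union_left, hx, hy, hGc.isPreconnected⟩
    · refine ⟨G ∪ U, union_subset_union_right _ (subset_sUnion_of_mem hU), Or.inl hx, Or.inr hyU,
        ?_⟩
      obtain ⟨hUc, w, hwU, hwG⟩ := hU
      obtain ⟨u, huU, huG⟩ := mem_closure_iff.1 hwG.1 U hUc.isOpen hwU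
      exact hGc.isPreconnected.union u huG huU hUc.isPreconnected
  have hVb : Bornology.IsBounded V := by
    obtain ⟨t, ht⟩ := hGb.subset_closedBall 0
    obtain ⟨B, hB, hBU⟩ := exists_isBounded_of_inter hf hR hM hweb t
    refine hGb.union (hB.subset (sUnion_subset fun U hU => ?_))
    refine hBU U hU.1.isPreconnected hU.1.subset (hU.2.mono (inter_subset_inter_right _ ?_))
    exact frontier_subset_closure.trans (closure_minimal ht Metric.isClosed_closedBall)
  have hfr : frontier V ⊆ fastEscapingLevel f R ∩ juliaSet f := by
    intro x hx
    rw [hVo.frontier_eq] at hx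
    obtain ⟨hxcl, hxV⟩ := hx
    have hclV : closure V ⊆ G ∪ fastEscapingLevel f R := by
      rw [hV, closure_union]
      refine union_subset ?_ ?_
      · rw [closure_eq_self_union_frontier]
        exact union_subset_union_right _ hGA
      · refine subset_union_of_subset_right ?_ _
        exact closure_minimal (sUnion_subset hUA) (isClosed_fastEscapingLevel hf.1.continuous)
    refine ⟨(hclV hxcl).resolve_left fun h => hxV (Or.inl h), fun hxF => ?_⟩
    have hW := isFatouComponent_connectedComponentIn hxF
    have hxW := mem_connectedComponentIn hxF
    obtain ⟨y, hyW, hy | ⟨U, hU, hyU⟩⟩ := mem_closure_iff.1 hxcl _ hW.isOpen hxW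
    · exact hxV (Or.inr ⟨_, ⟨hW, inter_frontier_nonempty hW.isPreconnected ⟨y, hyW, hy⟩
        ⟨x, hxW, fun h => hxV (Or.inl h)⟩⟩, hxW⟩)
    · exact hxV (Or.inr ⟨U, hU,
        hU.1.subset_of_inter hW.isPreconnected hW.subset ⟨y, hyW, hyU⟩ hxW⟩)
  obtain ⟨W, hWo, hWs, hWb, hVW, hWV⟩ := exists_isSimplyConnected_superset hVo hVc hVb
  exact ⟨W, hWo, hWs, hWb, hGs.trans (subset_union_left.trans hVW), hWV.trans hfr⟩

/-- Adjoining to a closed subset of the Julia set the Fatou components with boundary in it gives a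
closed set. -/
theorem isClosed_union_components {E : Set ℂ} (hE : IsClosed E) (hEJ : E ⊆ juliaSet f) :
    IsClosed (E ∪ ⋃₀ {U | IsFatouComponent f U ∧ frontier U ⊆ E}) := by
  refine isClosed_of_closure_subset fun x hx => ?_
  by_cases hxF : x ∈ fatouSet f
  · have hW := isFatouComponent_connectedComponentIn hxF
    have hxW := mem_connectedComponentIn hxF
    obtain ⟨y, hyW, hy | ⟨U, hU, hyU⟩⟩ := mem_closure_iff.1 hx _ hW.isOpen hxW
    · exact absurd (hW.subset hyW) (hEJ hy)
    · exact Or.inr ⟨U, hU, hU.1.subset_of_inter hW.isPreconnected hW.subset ⟨y, hyW, hyU⟩ hxW⟩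
  · refine Or.inl (by_contra fun hxE => ?_)
    obtain ⟨ε, hε, hball⟩ := Metric.isOpen_iff.1 hE.isOpen_compl x hxE
    have hx0 := Metric.mem_ball_self (x := x) hε
    obtain ⟨y, hyB, hy | ⟨U, hU, hyU⟩⟩ := mem_closure_iff.1 hx _ Metric.isOpen_ball hx0
    · exact hball hyB hy
    · obtain ⟨w, hwB, hw⟩ := inter_frontier_nonempty (convex_ball x ε).isPreconnected
        ⟨y, hyB, hyU⟩ ⟨x, hx0, fun h => hxF (hU.1.subset h)⟩
      exact hball hwB (hU.2 hw)

section Web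

variable (hf : IsTranscendentalEntire f) (hR : 0 < R)
  (hM : ∀ r : ℝ, R ≤ r → r < maxModulus f r) (hweb : IsSpidersWeb (fastEscapingLevel f R))
  (hsc : ∀ U : Set ℂ, IsFatouComponent f U → IsSimplyConnected U)

include hf hR hM hweb hsc

theorem not_isBounded_inter_juliaSet :
    ¬ Bornology.IsBounded (fastEscapingLevel f R ∩ juliaSet f) := by
  intro hb
  obtain ⟨s, hs⟩ := hb.subset_closedBall 0
  obtain ⟨G, hGo, hGs, hGb, hGsub, hGE⟩ :=
    exists_frontier_subset_inter_juliaSet hf hR hM hweb hsc s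
  obtain ⟨x, hx⟩ := frontier_nonempty_of_isBounded hGb hGs.isPathConnected.nonempty
  have h1 := hGsub (hs (hGE hx))
  rw [hGo.frontier_eq] at hx
  exact hx.2 h1

theorem isConnected_inter_juliaSet : IsConnected (fastEscapingLevel f R ∩ juliaSet f) := by
  have hunb := not_isBounded_inter_juliaSet hf hR hM hweb hsc
  have hJ := juliaSet_nonempty hf hR hM hweb
  have hcl : IsClosed (fastEscapingLevel f R ∩ juliaSet f) :=
    (isClosed_fastEscapingLevel hf.1.continuous).inter (isClosed_juliaSet f)
  refine ⟨?_, isPreconnected_closed_iff.2 fun t t' ht ht' hsub hne hne' => ?_⟩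
  · rw [nonempty_iff_ne_empty]
    intro h
    exact hunb (h ▸ Bornology.isBounded_empty)
  by_contra hcon
  rw [not_nonempty_iff_eq_empty] at hcon
  set E := fastEscapingLevel f R ∩ juliaSet f with hE
  have hdisj : ∀ x, x ∈ E → x ∈ t → x ∉ t' := fun x hx h1 h2 =>
    (hcon ▸ ⟨hx, h1, h2⟩ : x ∈ (∅ : Set ℂ))
  have hA1 := isClosed_union_components (f := f) (hcl.inter ht) (fun x hx => hx.1.2)
  have hA2 := isClosed_union_components (f := f) (hcl.inter ht') (fun x hx => hx.1.2)
  obtain ⟨w, hwA, hw1, hw2⟩ := isPreconnected_closed_iff.1 hweb.1.isPreconnected _ _ hA1 hA2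
    (by
      intro z hz
      by_cases hzF : z ∈ fatouSet f
      · have hW := isFatouComponent_connectedComponentIn hzF
        have hzW := mem_connectedComponentIn hzF
        have hfrE : frontier (connectedComponentIn (fatouSet f) z) ⊆ E := fun x hx =>
          ⟨closure_subset_fastEscapingLevel hf hR hM hJ hsc hW ⟨z, hzW, hz⟩
            (frontier_subset_closure hx), hW.frontier_subset hx⟩
        have hfrc := isPreconnected_frontier hW.isOpen hW.isPreconnected
          (isPreconnected_compl_of_isSimplyConnected hW.isOpen (hsc _ hW)
            (hW.isBounded hf hR hM hweb))
        rcases isPreconnected_iff_subset_of_disjoint_closed.1 hfrc t t' ht ht'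
          (hfrE.trans hsub) (by
            rw [eq_empty_iff_forall_notMem]
            rintro x ⟨hx, h1, h2⟩
            exact hdisj x (hfrE hx) h1 h2) with h | h
        · exact Or.inl (Or.inr ⟨_, ⟨hW, subset_inter hfrE h⟩, hzW⟩)
        · exact Or.inr (Or.inr ⟨_, ⟨hW, subset_inter hfrE h⟩, hzW⟩)
      · exact (hsub ⟨hz, hzF⟩).imp (fun h => Or.inl ⟨⟨hz, hzF⟩, h⟩) fun h => Or.inl ⟨⟨hz, hzF⟩, h⟩)
    (by
      obtain ⟨x, hx, hxt⟩ := hne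
      exact ⟨x, hx.1, Or.inl ⟨hx, hxt⟩⟩)
    (by
      obtain ⟨x, hx, hxt⟩ := hne'
      exact ⟨x, hx.1, Or.inl ⟨hx, hxt⟩⟩)
  rcases hw1 with hw1 | ⟨U, ⟨hU, hUf⟩, hwU⟩
  · rcases hw2 with hw2 | ⟨U, ⟨hU, hUf⟩, hwU⟩
    · exact hdisj w hw1.1 hw1.2 hw2.2
    · exact hw1.1.2 (hU.subset hwU)
  · rcases hw2 with hw2 | ⟨U', ⟨hU', hUf'⟩, hwU'⟩
    · exact hw2.1.2 (hU.subset hwU)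
    · have hUU : U = U' := by rw [hU.eq_of_mem hwU, hU'.eq_of_mem hwU']
      subst hUU
      obtain ⟨x, hx⟩ := frontier_nonempty_of_isBounded (hU.isBounded hf hR hM hweb) hU.nonempty
      exact hdisj x (hUf hx).1 (hUf hx).2 (hUf' hx).2

theorem isPreconnected_preimage_iterate (L : ℕ) :
    IsPreconnected (f^[L] ⁻¹' (fastEscapingLevel f R ∩ juliaSet f)) := by
  have hunb := not_isBounded_inter_juliaSet hf hR hM hweb hsc
  have hcon := (isConnected_inter_juliaSet hf hR hM hweb hsc).isPreconnected
  have hcl : IsClosed (fastEscapingLevel f R ∩ juliaSet f) :=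
    (isClosed_fastEscapingLevel hf.1.continuous).inter (isClosed_juliaSet f)
  have hcont := hf.1.continuous.iterate L
  have hinv : fastEscapingLevel f R ∩ juliaSet f ⊆
      f^[L] ⁻¹' (fastEscapingLevel f R ∩ juliaSet f) := fun x hx =>
    ⟨iterate_mem_fastEscapingLevel hM hx.1 L, (iterate_mem_juliaSet_iff hf L).2 hx.2⟩
  set E := fastEscapingLevel f R ∩ juliaSet f with hE
  have hB : IsClosed (f^[L] ⁻¹' E) := hcl.preimage hcont
  set B := f^[L] ⁻¹' E with hBdef
  have key : ∀ P Q : Set ℂ, IsClosed P → IsClosed Q → B ⊆ P ∪ Q → (B ∩ (P ∩ Q)) = ∅ → E ⊆ Q →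
      B ⊆ Q := by
    intro P Q hP hQ hPQ hdis hEQ p hpB
    by_contra hpQ
    have hpP := (hPQ hpB).resolve_right hpQ
    obtain ⟨G, hGo, -, hGb, hGsub, hGE⟩ :=
      exists_frontier_subset_inter_juliaSet hf hR hM hweb hsc ‖p‖
    have hpG : p ∈ G := hGsub (by simp)
    have hdis' : ∀ x ∈ B, x ∈ P → x ∉ Q := fun x hx h1 h2 =>
      (hdis ▸ ⟨hx, h1, h2⟩ : x ∈ (∅ : Set ℂ))
    have hPG : B ∩ P ∩ G = B ∩ P ∩ closure G := by
      refine subset_antisymm (inter_subset_inter_right _ subset_closure) ?_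
      rintro x ⟨⟨hxB, hxP⟩, hxG⟩
      refine ⟨⟨hxB, hxP⟩, by_contra fun hxG' => ?_⟩
      exact hdis' x hxB hxP (hEQ (hGE (by rw [hGo.frontier_eq]; exact ⟨hxG, hxG'⟩)))
    have hK : IsCompact (B ∩ P ∩ G) := by
      rw [hPG]
      exact hGb.isCompact_closure.inter_left (hB.inter hP)
    have hQ' : IsClosed (B ∩ Q ∪ B ∩ P ∩ Gᶜ) :=
      (hB.inter hQ).union ((hB.inter hP).inter hGo.isClosed_compl)
    obtain ⟨δ, hδ, hδsub⟩ := hK.exists_cthickening_subset_open hQ'.isOpen_compl (by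
      rintro x ⟨⟨hxB, hxP⟩, hxG⟩ (h | h)
      · exact hdis' x hxB hxP h.2
      · exact h.2 hxG)
    set O := Metric.thickening δ (B ∩ P ∩ G) with hO
    have hOo : IsOpen O := Metric.isOpen_thickening
    have hclO : closure O ⊆ Metric.cthickening δ (B ∩ P ∩ G) :=
      Metric.closure_thickening_subset_cthickening _ _
    have hOb : Bornology.IsBounded O := hK.isBounded.thickening
    have himg : IsCompact (f^[L] '' closure O) := hOb.isCompact_closure.image hcont
    have hcap : ∀ x ∈ closure O, f^[L] x ∈ E → x ∈ O := by
      intro x hx hxE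
      refine Metric.self_subset_thickening hδ _ ?_
      have h1 := hδsub (hclO hx)
      have hxB : x ∈ B := hxE
      have hxQ : x ∉ Q := fun h => h1 (Or.inl ⟨hxB, h⟩)
      have hxP := (hPQ hxB).resolve_right hxQ
      exact ⟨⟨hxB, hxP⟩, by_contra fun h => h1 (Or.inr ⟨⟨hxB, hxP⟩, h⟩)⟩
    refine hunb (himg.isBounded.subset fun y hy => by_contra fun hyO => ?_)
    obtain ⟨u, -, ⟨v, hv, rfl⟩, hu⟩ := hcon (f^[L] '' O) (f^[L] '' closure O)ᶜ
      (hf.isOpenMap_iterate L O hOo) himg.isClosed.isOpen_compl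
      (fun x hx => by
        by_cases hxO : x ∈ f^[L] '' closure O
        · obtain ⟨v, hv, rfl⟩ := hxO
          exact Or.inl ⟨v, hcap v hv hx, rfl⟩
        · exact Or.inr hxO)
      ⟨f^[L] p, hpB, p, Metric.self_subset_thickening hδ _ ⟨⟨hpB, hpP⟩, hpG⟩, rfl⟩
      ⟨y, hy, hyO⟩
    exact hu ⟨v, subset_closure hv, rfl⟩
  refine isPreconnected_iff_subset_of_disjoint_closed.2 fun P Q hP hQ hPQ hdis => ?_
  rcases isPreconnected_iff_subset_of_disjoint_closed.1 hcon P Q hP hQ (hinv.trans hPQ)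
    (subset_empty_iff.1 ((inter_subset_inter_left _ hinv).trans hdis.subset)) with h | h
  · exact Or.inl (key Q P hQ hP (by rwa [union_comm]) (by rwa [inter_comm Q]) h)
  · exact Or.inr (key P Q hP hQ hPQ hdis h)

theorem isConnected_fastEscapingSet_inter_juliaSet :
    IsConnected (fastEscapingSet f R ∩ juliaSet f) := by
  have hE := isConnected_inter_juliaSet hf hR hM hweb hsc
  obtain ⟨x, hxA, hxJ⟩ := hE.nonempty
  have heq : fastEscapingSet f R ∩ juliaSet f =
      ⋃ L : ℕ, f^[L] ⁻¹' (fastEscapingLevel f R ∩ juliaSet f) := by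
    ext z
    simp only [mem_inter_iff, mem_fastEscapingSet_iff, mem_iUnion, mem_preimage,
      iterate_mem_juliaSet_iff hf, exists_and_right]
  refine ⟨⟨x, fastEscapingLevel_subset_fastEscapingSet hxA, hxJ⟩, ?_⟩
  rw [heq]
  refine isPreconnected_iUnion ⟨x, mem_iInter.2 fun L => ?_⟩
    fun L => isPreconnected_preimage_iterate hf hR hM hweb hsc L
  exact ⟨iterate_mem_fastEscapingLevel hM hxA L, (iterate_mem_juliaSet_iff hf L).2 hxJ⟩

end Web

/-- A sequence of holomorphic functions each of which is bounded by `C`, or bounded below by `δ`,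
on a disc is normal on a smaller concentric disc. -/
theorem isNormalFamilyOn_of_le_or_le {F : ℕ → ℂ → ℂ} {z : ℂ} {r δ C : ℝ} (hr : 0 < r) (hδ : 0 < δ)
    (hd : ∀ n, Differentiable ℂ (F n))
    (h : ∀ n, (∀ x ∈ Metric.ball z r, ‖F n x‖ ≤ C) ∨ ∀ x ∈ Metric.ball z r, δ ≤ ‖F n x‖) :
    IsNormalFamilyOn F (Metric.ball z (r / 4)) := by
  have hbdd : ∀ (φ : ℕ → ℕ) (B : ℝ),
      (∃ᶠ n in atTop, ∀ x ∈ Metric.ball z (r / 2), ‖F (φ n) x‖ ≤ B) →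
      ∃ ψ : ℕ → ℕ, StrictMono ψ ∧ ∃ g : ℂ → ℂ,
        TendstoLocallyUniformlyOn (fun n => F (φ (ψ n))) g atTop (Metric.ball z (r / 4)) := by
    intro φ B hB
    obtain ⟨ψ, hψ, hψB⟩ := extraction_of_frequently_atTop hB
    obtain ⟨χ, hχ, g, hg⟩ := exists_subseq_tendstoLocallyUniformlyOn (half_pos hr)
      (fun n => (hd (φ (ψ n))).differentiableOn) hψB
    refine ⟨ψ ∘ χ, hψ.comp hχ, g, ?_⟩
    rwa [show r / 2 / 2 = r / 4 by ring] at hg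
  have hsub : Metric.ball z (r / 2) ⊆ Metric.ball z r := Metric.ball_subset_ball (by linarith)
  intro φ
  by_cases h1 : ∃ᶠ n in atTop, ∀ x ∈ Metric.ball z r, ‖F (φ n) x‖ ≤ C
  · obtain ⟨ψ, hψ, hg⟩ := hbdd φ C (h1.mono fun n hn x hx => hn x (hsub hx))
    exact ⟨ψ, hψ, Or.inl hg⟩
  have h2 : ∀ᶠ n in atTop, ∀ x ∈ Metric.ball z r, δ ≤ ‖F (φ n) x‖ := by
    rw [not_frequently] at h1
    filter_upwards [h1] with n hn using (h (φ n)).resolve_left hn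
  set g : ℕ → ℂ → ℂ := fun n x => (2 / δ : ℝ) * F (φ n) x with hg
  have hgd : ∀ n, Differentiable ℂ (g n) := fun n => (hd (φ n)).const_mul _
  have hgnorm : ∀ n x, ‖g n x‖ = 2 / δ * ‖F (φ n) x‖ := by
    intro n x
    rw [hg, norm_mul, Complex.norm_real, Real.norm_of_nonneg (by positivity)]
  have hg1 : ∀ᶠ n in atTop, ∀ x ∈ Metric.ball z r, 1 < ‖g n x‖ := by
    filter_upwards [h2] with n hn x hx
    rw [hgnorm]
    calc (1 : ℝ) < 2 / δ * δ := by field_simp; norm_num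
      _ ≤ _ := by gcongr; exact hn x hx
  by_cases h3 : Tendsto (fun n => ‖g n z‖) atTop atTop
  · refine ⟨id, strictMono_id, Or.inr fun K hK _ B => ?_⟩
    obtain ⟨n₀, hn₀⟩ := exists_nat_ge (max 1 (2 / δ * B))
    filter_upwards [hg1, h3.eventually (eventually_ge_atTop ((n₀ : ℝ) ^ 3))] with n hn1 hn2 x hx
    have hxz : dist x z < r / 4 := hK hx
    have hsubx : Metric.ball x (r / 2) ⊆ Metric.ball z r := Metric.ball_subset_ball' (by linarith)
    have hlog := log_norm_le_three_mul (half_pos hr) (hgd n).differentiableOn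
      (fun w hw => hn1 w (hsubx hw)) (z := z) (by
        rw [Metric.mem_closedBall, dist_comm]
        linarith)
    have hn₁ : (1 : ℝ) ≤ n₀ := (le_max_left _ _).trans hn₀
    have hx1 := hn1 x (hsubx (Metric.mem_ball_self (half_pos hr)))
    have h4 : Real.log ((n₀ : ℝ) ^ 3) ≤ Real.log ‖g n z‖ := Real.log_le_log (by positivity) hn2
    rw [Real.log_pow] at h4
    push_cast at h4
    have h5 : (n₀ : ℝ) ≤ ‖g n x‖ :=
      (Real.log_le_log_iff (by linarith) (by linarith)).1 (by linarith)
    have h6 : 2 / δ * B ≤ 2 / δ * ‖F (φ n) x‖ := by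
      rw [← hgnorm]
      exact (le_max_right _ _).trans (hn₀.trans h5)
    exact le_of_mul_le_mul_left h6 (by positivity)
  · obtain ⟨B, hB⟩ : ∃ B : ℝ, ∃ᶠ n in atTop, ‖g n z‖ < B := by
      rw [tendsto_atTop] at h3
      push Not at h3
      exact h3
    obtain ⟨ψ, hψ, hlim⟩ := hbdd φ (δ / 2 * max 1 B ^ 3) (by
      refine (hB.and_eventually hg1).mono fun n hn x hx => ?_
      have hlog := log_norm_le_three_mul hr (hgd n).differentiableOn hn.2
        (Metric.ball_subset_closedBall hx)
      have hz1 := hn.2 z (Metric.mem_ball_self hr)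
      have hx1 := hn.2 x (hsub hx)
      have h4 : Real.log ‖g n z‖ ≤ Real.log (max 1 B) :=
        Real.log_le_log (by linarith) (hn.1.le.trans (le_max_right _ _))
      have h5 : ‖g n x‖ ≤ max 1 B ^ 3 := by
        refine (Real.log_le_log_iff (by linarith) (by positivity)).1 ?_
        rw [Real.log_pow]
        push_cast
        linarith
      rw [hgnorm] at h5
      calc ‖F (φ n) x‖ = δ / 2 * (2 / δ * ‖F (φ n) x‖) := by field_simp
        _ ≤ _ := by gcongr)
    exact ⟨ψ, hψ, Or.inl hlim⟩

section Web

variable (hf : IsTranscendentalEntire f) (hR : 0 < R)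
  (hM : ∀ r : ℝ, R ≤ r → r < maxModulus f r) (hweb : IsSpidersWeb (fastEscapingLevel f R))

include hf hweb

/-- The fast escaping set accumulates at every point of the Julia set. -/
theorem ball_inter_fastEscapingSet_nonempty {z : ℂ} (hz : z ∈ juliaSet f) {ε : ℝ} (hε : 0 < ε) :
    (Metric.ball z ε ∩ fastEscapingSet f R).Nonempty := by
  by_contra hne
  have hmiss : ∀ x ∈ Metric.ball z ε, x ∉ fastEscapingSet f R := fun x hx hxA => hne ⟨x, hx, hxA⟩
  obtain ⟨G, hGo, hGb, hG0, hGA⟩ := hweb.exists_mem_zero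
  obtain ⟨δ, hδ, hδG⟩ := Metric.isOpen_iff.1 hGo 0 hG0
  obtain ⟨C, hC⟩ := hGb.subset_closedBall 0
  refine hz ⟨ε / 4, by positivity, isNormalFamilyOn_of_le_or_le (δ := δ) (C := C) hε hδ
    (fun n => hf.1.iterate n) fun n => ?_⟩
  by_cases hG : (f^[n] '' Metric.ball z ε ∩ G).Nonempty
  · refine Or.inl fun x hx => ?_
    by_contra hxC
    obtain ⟨y, ⟨w, hw, rfl⟩, hy⟩ := inter_frontier_nonempty
      ((convex_ball z ε).isPreconnected.image _ (hf.1.continuous.iterate n).continuousOn) hG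
      ⟨f^[n] x, ⟨x, hx, rfl⟩, fun h => hxC (mem_closedBall_zero_iff.1 (hC h))⟩
    exact hmiss w hw (mem_fastEscapingSet_iff.2 ⟨n, hGA hy⟩)
  · refine Or.inr fun x hx => ?_
    by_contra! hlt
    exact hG ⟨f^[n] x, ⟨x, hx, rfl⟩, hδG (mem_ball_zero_iff.2 hlt)⟩

include hR hM

theorem juliaSet_subset_closure
    (hsc : ∀ U : Set ℂ, IsFatouComponent f U → IsSimplyConnected U) :
    juliaSet f ⊆ closure (fastEscapingSet f R ∩ juliaSet f) := by
  intro z hz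
  rw [Metric.mem_closure_iff]
  intro ε hε
  suffices h : ∃ y ∈ Metric.ball z ε, y ∈ fastEscapingSet f R ∩ juliaSet f by
    obtain ⟨y, hy, hy'⟩ := h
    exact ⟨y, hy', Metric.mem_ball'.1 hy⟩
  obtain ⟨x, hxB, hxA⟩ := ball_inter_fastEscapingSet_nonempty hf hweb hz hε
  by_cases hxF : x ∈ fatouSet f
  · have hU := isFatouComponent_connectedComponentIn hxF
    set U := connectedComponentIn (fatouSet f) x with hUdef
    have hxU : x ∈ U := mem_connectedComponentIn hxF
    obtain ⟨y, hyB, hy⟩ := inter_frontier_nonempty (convex_ball z ε).isPreconnected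
      ⟨x, hxB, hxU⟩ ⟨z, Metric.mem_ball_self hε, fun h => hz (hU.subset h)⟩
    refine ⟨y, hyB, mem_fastEscapingSet_iff.2 ?_, hU.frontier_subset hy⟩
    obtain ⟨L, hL⟩ := mem_fastEscapingSet_iff.1 hxA
    have hcont := hf.1.continuous.iterate L
    have hV := isFatouComponent_connectedComponentIn ((iterate_mem_fatouSet_iff hf L).2 hxF)
    have hxV := mem_connectedComponentIn ((iterate_mem_fatouSet_iff hf L).2 hxF)
    have hUV : f^[L] '' U ⊆ connectedComponentIn (fatouSet f) (f^[L] x) := by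
      refine hV.subset_of_inter (hU.isPreconnected.image _ hcont.continuousOn) ?_
        ⟨_, ⟨x, hxU, rfl⟩, hxV⟩
      rintro _ ⟨w, hw, rfl⟩
      exact (iterate_mem_fatouSet_iff hf L).2 (hU.subset hw)
    refine ⟨L, closure_subset_fastEscapingLevel hf hR hM ⟨z, hz⟩ hsc hV ⟨_, hxV, hL⟩
      (closure_mono hUV ?_)⟩
    exact image_closure_subset_closure_image hcont ⟨y, frontier_subset_closure hy, rfl⟩
  · exact ⟨x, hxB, hxA, hxF⟩

end Web

end

end EntireDynamics

open EntireDynamics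
theorem theorem1p5 (f : ℂ → ℂ) (hf : IsTranscendentalEntire f)
    (R : ℝ) (hR : 0 < R) (hM : ∀ r : ℝ, R ≤ r → r < maxModulus f r)
    (hweb : IsSpidersWeb (fastEscapingLevel f R)) :
    ((∀ U : Set ℂ, ¬ IsMultiplyConnectedFatouComponent f U) →
      IsSpidersWeb (fastEscapingLevel f R ∩ juliaSet f) ∧
      IsSpidersWeb (fastEscapingSet f R ∩ juliaSet f) ∧
      IsSpidersWeb (escapingSet f ∩ juliaSet f) ∧
      IsSpidersWeb (juliaSet f)) ∧
    (∀ U : Set ℂ, IsFatouComponent f U → Bornology.IsBounded U) := by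
  refine ⟨fun hmc => ?_, fun U hU => hU.isBounded hf hR hM hweb⟩
  have hsc : ∀ U : Set ℂ, IsFatouComponent f U → IsSimplyConnected U := fun U hU =>
    by_contra fun h => hmc U ⟨hU, h⟩
  have hE := isConnected_inter_juliaSet hf hR hM hweb hsc
  have hA := isConnected_fastEscapingSet_inter_juliaSet hf hR hM hweb hsc
  have hsub1 : fastEscapingLevel f R ∩ juliaSet f ⊆ fastEscapingSet f R ∩ juliaSet f :=
    inter_subset_inter_left _ fastEscapingLevel_subset_fastEscapingSet
  have hsub2 : fastEscapingSet f R ∩ juliaSet f ⊆ escapingSet f ∩ juliaSet f :=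
    inter_subset_inter_left _ (fastEscapingSet_subset_escapingSet hf.1 hR hM)
  have hsub3 : escapingSet f ∩ juliaSet f ⊆ juliaSet f := inter_subset_right
  have hcl := juliaSet_subset_closure hf hR hM hweb hsc
  have hI := hA.subset_closure hsub2 (hsub3.trans hcl)
  have hJ := hA.subset_closure (hsub2.trans hsub3) hcl
  have hspider : ∀ E : Set ℂ, fastEscapingLevel f R ∩ juliaSet f ⊆ E → IsConnected E →
      IsSpidersWeb E := by
    intro E hsub hEc
    refine isSpidersWeb_of_forall_exists hEc fun s => ?_
    obtain ⟨G, h1, h2, h3, h4, h5⟩ :=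
      exists_frontier_subset_inter_juliaSet hf hR hM hweb hsc s
    exact ⟨G, h1, h2, h3, h4, h5.trans hsub⟩
  exact ⟨hspider _ subset_rfl hE, hspider _ hsub1 hA, hspider _ (hsub1.trans hsub2) hI,
    hspider _ (hsub1.trans (hsub2.trans hsub3)) hJ⟩
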